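/- Let \(R\) be a commutative \(\mathbb Q\)-algebra and let \(\beta^{1/2}\in R\) be an invertible element (\(\beta=(\beta^{1/2})^2\)). For a partition \(\mu\) of \(d\) let \[ D_\mu=\sum_{|\lambda|=d}\chi_\mu(\lambda)\,\frac{d_{\lambda_1}\cdots d_{\lambda_k}}{|\mathrm{Aut}(\lambda)|}, \] where the sum is over the partitions \(\lambda=(\lambda_1,\dots,\lambda_k)\) of \(d\), \(\chi_\mu(\lambda)\) is the character of a permutation of cycle type \(\lambda\) in the irreducible representation of \(S_d\) assigned to \(\mu\) (so that \((d)\) corresponds to the trivial representation), and \(|\mathrm{Aut}(\lambda)|\) is the number of permutations of the parts of \(\lambda\) preserving their values. For a formal power series \(\tau\) in variables \(x_1,x_2,\dots\) over \(R\), let \(D_\mu\tau\) be obtained with \(d_i=\partial/\partial x_i\), and for \(2\le i\le j\) put \[ \mathrm{Hir}_{i,j}(\tau)=D_{()}\tau\cdot D_{(j,i)}\tau-D_{(i-1)}\tau\cdot D_{(j,1)}\tau+D_{(j)}\tau\cdot D_{(i-1,1)}\tau . \] Consider the triangular change of variables \[ p_b=\sum_{m\ge b}(-1)^{m-b}\binom{m-1}{b-1}\beta^{-m/2}\,T_m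 , \qquad \frac{\partial}{\partial p_i}=\sum_{m=1}^{i}\binom{i-1}{m-1}\beta^{m/2}\frac{\partial}{\partial T_m}. \] **Proposition.** Let \(2\le i\le j\). There are rational constants \(c_{i',j'}\) (depending only on \(i,j\), not on \(R\), \(\beta^{1/2}\) or the series), with \(c_{i,j}=1\), such that the change of variables transforms \(\mathrm{Hir}_{i,j}\) in the variables \(p_1,p_2,\dots\) into \[ \sum_{\substack{2\le i'\le i,\;2\le j'\le j\\ i'\le j'}}c_{i',j'}\,\beta^{(i'+j')/2}\,\mathrm{Hir}_{i',j'} \] in the variables \(T_1,T_2,\dots\). That is: 1. if every \(\partial/\partial p_k\) in \(\mathrm{Hir}_{i,j}\) is replaced by its expression in the \(\partial/\partial T_m\), the resulting bilinear differential expression, applied to any formal power series \(\tau\in R[[T_1,T_2,\dots]]\), equals \(\sum c_{i',j'}\beta^{(i'+j')/2}\mathrm{Hir}_{i',j'}(\tau)\); 2. for every formal power series \(\tau\in R[[p_1,p_2,\dots]]\), substituting \(p=p(T)\) in \(\mathrm{Hir}_{i,j}(\tau)\) gives \(\sum c_{i',j'}\beta^{(i'+j')/2}\mathrm{Hir}_{i',j'}(\tilde\tau)\),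 where \(\tilde\tau(T)=\tau(p(T))\). -/

import Mathlib

open scoped BigOperators

noncomputable section

namespace HirotaKP

/-! ### Irreducible characters of the symmetric group -/

/-- The Young diagram whose row lengths are the entries of `l`, listed in decreasing order. -/
def diagram (l : List ℕ) : YoungDiagram :=
  YoungDiagram.ofRowLens (l.insertionSort (· ≥ ·)) List.sortedGE_insertionSort

/-- A tableau of shape `μ`: it places each label `a : Fin |μ|` in a cell `(row, column)` of `μ`. -/
abbrev Tableau (μ : YoungDiagram) : Type := Fin μ.card ≃ {x : ℕ × ℕ // x ∈ μ.cells}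

/-- The Specht polynomial of a tableau: the product of `X a - X b` over all pairs of labels such
that `a` stands above `b` in the same column. -/
def spechtPoly {μ : YoungDiagram} (t : Tableau μ) : MvPolynomial (Fin μ.card) ℚ :=
  ∏ a, ∏ b, if (t a).1.2 = (t b).1.2 ∧ (t a).1.1 < (t b).1.1
    then MvPolynomial.X a - MvPolynomial.X b else 1

/-- The symmetric group acting on polynomials by permutation of the variables. -/
def permRep (n : ℕ) :
    Representation ℚ (Equiv.Perm (Fin n)) (MvPolynomial (Fin n) ℚ) where
  toFun σ := (MvPolynomial.rename σ).toLinearMap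
  map_one' := by
    refine LinearMap.ext fun p => ?_
    change MvPolynomial.rename id p = p
    exact MvPolynomial.rename_id_apply p
  map_mul' σ τ := by
    refine LinearMap.ext fun p => ?_
    exact (MvPolynomial.rename_rename τ σ p).symm

/-- The Specht module of shape `μ`: the span of the Specht polynomials of all tableaux. -/
def spechtModule (μ : YoungDiagram) : Submodule ℚ (MvPolynomial (Fin μ.card) ℚ) :=
  Submodule.span ℚ (Set.range (spechtPoly (μ := μ)))

theorem permRep_spechtPoly {μ : YoungDiagram} (σ : Equiv.Perm (Fin μ.card)) (t : Tableau μ) :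
    permRep μ.card σ (spechtPoly t) = spechtPoly (σ.symm.trans t) := by
  change MvPolynomial.rename σ (spechtPoly t) = _
  simp only [spechtPoly, map_prod, apply_ite (MvPolynomial.rename σ), map_sub, map_one,
    MvPolynomial.rename_X]
  refine Fintype.prod_equiv σ _ _ fun a => Fintype.prod_equiv σ _ _ fun b => ?_
  have h : ∀ c, (σ.symm.trans t) (σ c) = t c := fun c => by simp
  simp only [h]

theorem spechtModule_le_comap (μ : YoungDiagram) (σ : Equiv.Perm (Fin μ.card)) :
    spechtModule μ ≤ (spechtModule μ).comap (permRep μ.card σ) := by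
  refine Submodule.span_le.2 ?_
  rintro _ ⟨t, rfl⟩
  change permRep μ.card σ (spechtPoly t) ∈ spechtModule μ
  rw [permRep_spechtPoly]
  exact Submodule.subset_span ⟨_, rfl⟩

/-- The irreducible representation of `S_d`, `d = |μ|`, assigned to `μ`, in Specht's realization. -/
def spechtRep (μ : YoungDiagram) :
    Representation ℚ (Equiv.Perm (Fin μ.card)) (spechtModule μ) :=
  (permRep μ.card).subrepresentation (spechtModule μ) (spechtModule_le_comap μ)

theorem exists_perm_parts {n : ℕ} (l : Nat.Partition n) :
    ∃ σ : Equiv.Perm (Fin n), σ.partition.parts = l.parts := by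
  classical
  have hle : (l.parts.filter (fun a => 2 ≤ a)).sum ≤ n := by
    conv_rhs => rw [← l.parts_sum]
    rw [← Multiset.sum_filter_add_sum_filter_not (fun a => 2 ≤ a) (s := l.parts)]
    exact Nat.le_add_right _ _
  obtain ⟨σ, hσ⟩ := (Equiv.Perm.exists_with_cycleType_iff (Fin n)
    (m := l.parts.filter (fun a => 2 ≤ a))).2
      ⟨by simpa using hle, fun a ha => (Multiset.mem_filter.1 ha).2⟩
  have hone : l.parts.filter (fun a => ¬ 2 ≤ a)
      = Multiset.replicate (Multiset.card (l.parts.filter (fun a => ¬ 2 ≤ a))) 1 := by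
    refine Multiset.eq_replicate_card.2 fun a ha => ?_
    have h1 := Multiset.mem_filter.1 ha
    have h2 := l.parts_pos h1.1
    omega
  have hsum := l.parts_sum
  rw [← Multiset.sum_filter_add_sum_filter_not (fun a => 2 ≤ a) (s := l.parts)] at hsum
  rw [hone] at hsum
  simp only [Multiset.sum_replicate, smul_eq_mul, mul_one] at hsum
  refine ⟨σ, ?_⟩
  rw [Equiv.Perm.parts_partition, ← Equiv.Perm.sum_cycleType, hσ]
  conv_rhs => rw [← Multiset.filter_add_not (fun a => 2 ≤ a) l.parts, hone]
  congr 2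
  simp only [Fintype.card_fin]
  omega

/-- A permutation with cycle type `l` (fixed points are counted as parts equal to `1`). -/
def permOfPartition {n : ℕ} (l : Nat.Partition n) : Equiv.Perm (Fin n) :=
  (exists_perm_parts l).choose

/-- `χ_μ(l)`: the character of any permutation with cycle type `l` in the irreducible
representation assigned to `μ`. -/
def chi (μ : YoungDiagram) (l : Nat.Partition μ.card) : ℚ :=
  (spechtRep μ).character (permOfPartition l)

/-- `|Aut(l)|`: the number of permutations of the parts of `l` that preserve their values. -/
def autCard {n : ℕ} (l : Nat.Partition n) : ℕ :=
  ∏ a ∈ l.parts.toFinset, (l.parts.count a).factorial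

/-! ### The operators `D_μ`

Throughout, the index `k : ℕ` stands for the variable number `k + 1`: in polynomials
`MvPolynomial.X k` is `d_{k+1}`, and in power series `MvPowerSeries.X k` is `p_{k+1}`
(or `T_{k+1}`). -/

/-- `D_μ` as a polynomial in the symbols `d_1, d_2, …`:
the sum over the partitions `l` of `|μ|` of `χ_μ(l) d_{l_1} ⋯ d_{l_k} / |Aut(l)|`. -/
def D (μ : YoungDiagram) : MvPolynomial ℕ ℚ :=
  ∑ l : Nat.Partition μ.card,
    MvPolynomial.C (chi μ l / (autCard l : ℚ)) *
      (l.parts.map fun a => MvPolynomial.X (a - 1)).prod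

section Operators

variable {R : Type*} [CommRing R]

/-- The `R`-linear operator of partial differentiation by variable number `k + 1` on formal power
series in infinitely many variables. -/
def partialOp (R : Type*) [CommRing R] (k : ℕ) : Module.End R (MvPowerSeries ℕ R) :=
  (MvPowerSeries.pderiv R k).toLinearMap

theorem partialOp_comm (k l : ℕ) :
    partialOp R k * partialOp R l = partialOp R l * partialOp R k := by
  refine LinearMap.ext fun f => MvPowerSeries.ext fun n => ?_
  change MvPowerSeries.coeff n (MvPowerSeries.pderiv R k (MvPowerSeries.pderiv R l f))
    = MvPowerSeries.coeff n (MvPowerSeries.pderiv R l (MvPowerSeries.pderiv R k f))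
  rcases eq_or_ne k l with rfl | h
  · rfl
  · simp only [MvPowerSeries.coeff_pderiv, Finsupp.add_apply, Finsupp.single_apply, h, h.symm,
      if_false, add_zero]
    rw [add_right_comm n]
    ring

theorem partialOp_range_comm :
    ∀ a ∈ Set.range (partialOp R), ∀ b ∈ Set.range (partialOp R), a * b = b * a := by
  rintro _ ⟨k, rfl⟩ _ ⟨l, rfl⟩
  exact partialOp_comm k l

open scoped IsMulCommutative in
/-- The differential operator with constant coefficients given by a polynomial in the symbols
`d_1, d_2, …`: each `d_i` acts as the derivative with respect to variable number `i`. -/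
def diffOp (R : Type*) [CommRing R] :
    MvPolynomial ℕ R →ₐ[R] Module.End R (MvPowerSeries ℕ R) :=
  haveI := Algebra.isMulCommutative_adjoin R (partialOp_range_comm (R := R))
  (Algebra.adjoin R (Set.range (partialOp R))).val.comp
    (MvPolynomial.aeval fun k =>
      (⟨partialOp R k, Algebra.subset_adjoin ⟨k, rfl⟩⟩ :
        Algebra.adjoin R (Set.range (partialOp R))))

open scoped IsMulCommutative in
theorem diffOp_X (k : ℕ) (f : MvPowerSeries ℕ R) :
    diffOp R (MvPolynomial.X k) f = MvPowerSeries.pderiv R k f := by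
  simp [diffOp, partialOp]

/-! ### Hirota equations -/

/-- The expression `D_() τ · D_(j,i) τ - D_(i-1) τ · D_(j,1) τ + D_(j) τ · D_(i-1,1) τ`, where
`act P` is the series that the operator `P` produces from `τ`. -/
def hirotaForm (act : MvPolynomial ℕ ℚ → MvPowerSeries ℕ R) (i j : ℕ) : MvPowerSeries ℕ R :=
  act (D (diagram [])) * act (D (diagram [j, i]))
    - act (D (diagram [i - 1])) * act (D (diagram [j, 1]))
    + act (D (diagram [j])) * act (D (diagram [i - 1, 1]))

/-- `Hir_{i,j}(τ)`, with respect to the variables in which `τ` is written. -/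
def Hir [Algebra ℚ R] (i j : ℕ) (τ : MvPowerSeries ℕ R) : MvPowerSeries ℕ R :=
  hirotaForm (fun P => diffOp R (MvPolynomial.map (algebraMap ℚ R) P) τ) i j

/-! ### The change of variables

The unit `s` of the coefficient ring is `β^{1/2}`. -/

/-- The change of variables on differential operators with constant coefficients:
`∂/∂p_i = ∑_{m=1}^{i} binom(i-1, m-1) β^{m/2} ∂/∂T_m`. -/
def changeOp [Algebra ℚ R] (s : Rˣ) : MvPolynomial ℕ ℚ →ₐ[ℚ] MvPolynomial ℕ R :=
  MvPolynomial.aeval fun k => ∑ m ∈ Finset.range (k + 1),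
    MvPolynomial.C ((k.choose m : R) * (s : R) ^ (m + 1)) * MvPolynomial.X m

/-- The equation `Hir_{i,j}` for the variables `p_1, p_2, …`, rewritten in the variables
`T_1, T_2, …` and applied to a series in the `T_m`. -/
def transformedHir [Algebra ℚ R] (s : Rˣ) (i j : ℕ) (τ : MvPowerSeries ℕ R) : MvPowerSeries ℕ R :=
  hirotaForm (fun P => diffOp R (changeOp s P) τ) i j

/-- The infinite linear form `∑_m a_m T_{m+1}`. -/
def linearForm (a : ℕ → R) : MvPowerSeries ℕ R :=
  fun e => ∑ m ∈ e.support, if e = Finsupp.single m 1 then a m else 0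

/-- The series `p_{b+1}(T) = ∑_{m ≥ b} (-1)^{m-b} binom(m, b) β^{-(m+1)/2} T_{m+1}`. -/
def pOfT (s : Rˣ) (b : ℕ) : MvPowerSeries ℕ R :=
  linearForm fun m =>
    if b ≤ m then (-1) ^ (m - b) * (m.choose b : R) * ((s⁻¹ : Rˣ) : R) ^ (m + 1) else 0

theorem coeff_pOfT (s : Rˣ) (b : ℕ) (e : ℕ →₀ ℕ) :
    MvPowerSeries.coeff e (pOfT s b) = ∑ m ∈ e.support, if e = Finsupp.single m 1 then
      (if b ≤ m then (-1) ^ (m - b) * (m.choose b : R) * ((s⁻¹ : Rˣ) : R) ^ (m + 1) else 0)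
      else 0 := rfl

/-- The series `p_1(T), p_2(T), …` can be substituted into any formal power series. -/
theorem hasSubst_pOfT (s : Rˣ) : MvPowerSeries.HasSubst (pOfT s) where
  const_coeff b := by
    rw [← MvPowerSeries.coeff_zero_eq_constantCoeff_apply, coeff_pOfT]
    simp
  coeff_zero e := by
    refine (Set.finite_Iic (∑ m ∈ e.support, m)).subset fun b hb => ?_
    rw [Set.mem_ofPred_eq, coeff_pOfT] at hb
    obtain ⟨m, hm, h⟩ := Finset.exists_ne_zero_of_sum_ne_zero hb
    have hbm : b ≤ m := by
      by_contra hbm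
      simp [hbm] at h
    exact hbm.trans (Finset.single_le_sum (f := fun m => m) (fun _ _ => Nat.zero_le _) hm)

end Operators

end HirotaKP

end

noncomputable section

namespace HirotaKP

/-! ### The generating series of the one-row operators -/

/-! The proof runs through the one-row operators. Write `h_n` for `D_(n)`. Since trivial characters
equal 1, `∑ h_n z^n` is the exponential of `U(z) = ∑ d_k z^k`. The change of variables replaces
`U(z)` by `U(s z / (1 - z))`, hence the same substitution happens in the series of the `h_n`, and
`h_{n+1}` becomes `∑_m binom(n, m) s^(m+1) h_{m+1}` (`complete_binomial`).

Only diagrams with at most two rows occur, and for them Jacobi–Trudi gives `D_(j,i) = h_j h_i -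
h_{j+1} h_{i-1}` (`HasTwoRows.D_eq`). This is derived from the Specht modules: the squarefree
polynomials of degree `k` form the permutation module on `k`-sets, and as long as `2k < d` the
module in degree `k + 1` is the direct sum of the two-row Specht module and an injective image of
the module in degree `k`. So the character is a difference of two numbers of fixed sets. The fixed
sets of a permutation are counted by the product of `1 + t^a` over its cycle lengths `a`, which is
also what the product of two complete sums produces.

Consequently `Hir_{i,j}` is an expression `plucker` in the consecutive pairs `(h_{i-1}, h_i)` and
`(h_j, h_{j+1})`, bilinear and alternating in the pairs. By Pascal's rule the transformed pairs are
binomial combinations of pairs `(h_m, h_m + s h_{m+1})`, and `plucker_shift` shows that the extra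
summand `h_m` contributes nothing: it only pulls out a factor `s`. Thus `Hir_{i,j}` becomes a double
binomial sum of the same expressions, and antisymmetry folds it onto the indices `i' ≤ j'`, which
gives the constants `hirotaCoeff`.

The second claim reduces to the first by the chain rule for `p = p(T)` (`subst_diffOp`). -/

/-- The number of permutations of a multiset that preserve the values of its elements. -/
def multisetAut (m : Multiset ℕ) : ℕ := ∏ a ∈ m.toFinset, (m.count a).factorial

theorem multisetAut_eq_prod {m : Multiset ℕ} {s : Finset ℕ} (h : m.toFinset ⊆ s) :
    multisetAut m = ∏ a ∈ s, (m.count a).factorial := by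
  refine Finset.prod_subset h fun a _ ha => ?_
  rw [Multiset.mem_toFinset] at ha
  simp [Multiset.count_eq_zero_of_notMem ha]

theorem multisetAut_cons (a : ℕ) (m : Multiset ℕ) :
    multisetAut (a ::ₘ m) = (m.count a + 1) * multisetAut m := by
  rw [multisetAut_eq_prod (m := a ::ₘ m) (s := insert a m.toFinset) (by simp),
    multisetAut_eq_prod (m := m) (Finset.subset_insert a _),
    ← Finset.mul_prod_erase _ _ (Finset.mem_insert_self a m.toFinset),
    ← Finset.mul_prod_erase _ _ (Finset.mem_insert_self a m.toFinset), Multiset.count_cons_self,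
    Nat.factorial_succ, mul_assoc]
  congr 2
  refine Finset.prod_congr rfl fun b hb => ?_
  rw [Multiset.count_cons_of_ne (Finset.ne_of_mem_erase hb)]

/-! ### Powers of the Möbius series -/

section CommRing

variable {A : Type*} [CommRing A]

theorem multiset_prod_pow_mul (l : Multiset ℕ) (hl : ∀ a ∈ l, 0 < a) (t : A) (u : ℕ → A) :
    (l.map fun a => t ^ (a - 1 + 1) * u (a - 1)).prod
      = t ^ l.sum * (l.map fun a => u (a - 1)).prod := by
  induction l using Multiset.induction_on with
  | empty => simp
  | cons a s ih =>
    have ha := hl a (Multiset.mem_cons_self a s)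
    rw [Multiset.map_cons, Multiset.prod_cons, ih fun b hb => hl b (Multiset.mem_cons_of_mem hb),
      Multiset.map_cons, Multiset.prod_cons, Multiset.sum_cons, Nat.sub_add_cancel ha, pow_add]
    ring

/-- The power series `s X / (1 - X)`. -/
def mobius (s : A) : PowerSeries A := PowerSeries.X * PowerSeries.mk fun _ => s

/-- The power is `s^(m+1) X^(m+1) / (1 - X)^(m+1)`, and the negative binomial series supplies the
binomial coefficient. This is where the coefficients of the change of variables come from. -/
theorem coeff_mobius_pow (s : A) (m n : ℕ) :
    PowerSeries.coeff (n + 1) (mobius s ^ (m + 1)) = (n.choose m : A) * s ^ (m + 1) := by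
  have h : mobius s = PowerSeries.C s * (PowerSeries.X * PowerSeries.mk 1) := by
    ext k
    rw [mobius, PowerSeries.coeff_C_mul]
    cases k <;> simp
  rw [h, mul_pow, mul_pow, PowerSeries.mk_one_pow_eq_mk_choose_add, ← map_pow,
    PowerSeries.coeff_C_mul, PowerSeries.coeff_X_pow_mul', mul_comm]
  congr 1
  split_ifs with hmn
  · rw [PowerSeries.coeff_mk]
    congr 2
    omega
  · rw [Nat.choose_eq_zero_of_lt (by omega), Nat.cast_zero]

theorem coeff_subst_mobius (s : A) (f : PowerSeries A) (n : ℕ) :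
    PowerSeries.coeff (n + 1) (f.subst (mobius s)) = ∑ m ∈ Finset.range (n + 1),
      ((n.choose m : A) * s ^ (m + 1)) * PowerSeries.coeff (m + 1) f := by
  have hs : PowerSeries.HasSubst (mobius s) :=
    PowerSeries.HasSubst.of_constantCoeff_zero' (by simp [mobius])
  rw [PowerSeries.coeff_subst' hs, finsum_eq_sum_of_support_subset (s := Finset.range (n + 2)),
    Finset.sum_range_succ']
  · simp only [coeff_mobius_pow, smul_eq_mul]
    simp [mul_comm]
  · intro m hm
    rw [Function.mem_support] at hm
    cases m with
    | zero => simp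
    | succ m =>
      rw [coeff_mobius_pow] at hm
      by_contra hmn
      refine hm ?_
      rw [Nat.choose_eq_zero_of_lt (by simpa using hmn)]
      simp

end CommRing

/-! ### Complete sums as the coefficients of an exponential -/

section Complete

variable {A B : Type*} [CommRing A] [Algebra ℚ A] [CommRing B] [Algebra ℚ B]

/-- The sum over the partitions `l` of `n` of `u_{l_1} ⋯ u_{l_k} / |Aut(l)|`, where the entry of
`u` at `k` stands for the symbol number `k + 1`. -/
def complete (u : ℕ → A) (n : ℕ) : A :=
  ∑ l : Nat.Partition n, (1 / (multisetAut l.parts : ℚ)) • (l.parts.map fun a => u (a - 1)).prod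

theorem map_complete (f : A →+* B) (u : ℕ → A) (n : ℕ) :
    f (complete u n) = complete (fun k => f (u k)) n := by
  simp only [complete, map_sum, map_rat_smul, map_multiset_prod, Multiset.map_map]
  rfl

theorem complete_zero (u : ℕ → A) : complete u 0 = 1 := by
  simp [complete, multisetAut]

/-- The coefficient form of `H' = U' H`. In each partition of `n + 1`, the number `n + 1` is the sum
of the distinct parts weighted by their multiplicities. Removing one copy of a marked part leaves a
smaller partition, and the multiplicity cancels against the change of `|Aut|`. -/
theorem succ_mul_complete (u : ℕ → A) (n : ℕ) :
    ((n : A) + 1) * complete u (n + 1)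
      = ∑ x ∈ Finset.HasAntidiagonal.antidiagonal n, ((x.1 : A) + 1) * u x.1 * complete u x.2 := by
  have h1 : ((n : A) + 1) * complete u (n + 1) = ∑ l : Nat.Partition (n + 1),
      ∑ a ∈ l.parts.toFinset, ((l.parts.count a * a : ℕ) : A) *
        (1 / (multisetAut l.parts : ℚ)) • (l.parts.map fun a => u (a - 1)).prod := by
    rw [complete, Finset.mul_sum]
    refine Finset.sum_congr rfl fun l _ => ?_
    rw [← Finset.sum_mul]
    congr 1
    have := l.parts_sum
    rw [Finset.sum_multiset_count] at this
    rw [← Nat.cast_succ, Nat.succ_eq_add_one, ← congrArg (Nat.cast : ℕ → A) this, Nat.cast_sum]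
    rfl
  rw [h1, Finset.sum_sigma']
  simp_rw [complete, Finset.mul_sum]
  rw [Finset.sum_sigma']
  symm
  -- A symbol index `k` and a partition of `n - k` correspond to a partition of `n + 1` with the
  -- marked part `k + 1`.
  refine Finset.sum_bij (fun x hx => ⟨⟨(x.1.1 + 1) ::ₘ x.2.parts, ?_, ?_⟩, x.1.1 + 1⟩) ?_ ?_ ?_ ?_
  · intro i hi
    rcases Multiset.mem_cons.1 hi with rfl | hi
    · omega
    · exact x.2.parts_pos hi
  · have := Finset.HasAntidiagonal.mem_antidiagonal.1 (Finset.mem_sigma.1 hx).1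
    rw [Multiset.sum_cons, x.2.parts_sum]
    omega
  · intro x hx
    simp
  · rintro ⟨⟨k, m⟩, l⟩ hx ⟨⟨k', m'⟩, l'⟩ hx' h
    simp only [Finset.mem_sigma, Finset.HasAntidiagonal.mem_antidiagonal, Finset.mem_univ, and_true] at hx hx'
    simp only [Sigma.mk.injEq, Nat.Partition.mk.injEq, heq_eq_eq, add_left_inj] at h
    obtain ⟨h1, rfl⟩ := h
    obtain rfl : m = m' := by omega
    obtain rfl : l = l' := Nat.Partition.ext (Multiset.cons_inj_right _ |>.1 h1)
    rfl
  · rintro ⟨l, a⟩ h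
    simp only [Finset.mem_sigma, Finset.mem_univ, Multiset.mem_toFinset, true_and] at h
    have ha := l.parts_pos h
    have hs : a + (l.parts.erase a).sum = n + 1 := by
      rw [← Multiset.sum_cons, Multiset.cons_erase h, l.parts_sum]
    have ha' : a - 1 + 1 = a := by omega
    refine ⟨⟨(a - 1, (l.parts.erase a).sum), ⟨l.parts.erase a,
      fun hi => l.parts_pos (Multiset.mem_of_mem_erase hi), rfl⟩⟩, ?_, ?_⟩
    · simp only [Finset.mem_sigma, Finset.HasAntidiagonal.mem_antidiagonal, Finset.mem_univ, and_true]
      omega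
    · simp only [Sigma.mk.injEq, heq_eq_eq, ha', and_true]
      exact Nat.Partition.ext (Multiset.cons_erase h)
  · rintro ⟨⟨k, m⟩, l⟩ hx
    simp only [Multiset.count_cons_self, multisetAut_cons, Multiset.map_cons, Multiset.prod_cons,
      Nat.add_sub_cancel]
    have hc : ((l.parts.count (k + 1) : ℚ) + 1) ≠ 0 := by positivity
    rw [show ((((l.parts.count (k + 1) + 1) * (k + 1) : ℕ)) : A)
      = algebraMap ℚ A ((l.parts.count (k + 1) : ℚ) + 1) * ((k : A) + 1) by push_cast; simp]
    rw [Algebra.smul_def, Algebra.smul_def, show (1 / (multisetAut l.parts : ℚ))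
      = ((l.parts.count (k + 1) : ℚ) + 1) *
        (1 / (((l.parts.count (k + 1) + 1) * multisetAut l.parts : ℕ) : ℚ)) by
        push_cast; field_simp, map_mul]
    ring

/-- The generating series of the symbols. -/
def symbolSeries (u : ℕ → A) : PowerSeries A := PowerSeries.X * PowerSeries.mk u

/-- The generating series of the sums `complete u n`. -/
def completeSeries (u : ℕ → A) : PowerSeries A := PowerSeries.mk (complete u)

theorem derivative_completeSeries (u : ℕ → A) :
    PowerSeries.derivative A (completeSeries u)
      = PowerSeries.derivative A (symbolSeries u) * completeSeries u := by
  ext n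
  rw [PowerSeries.coeff_derivative, PowerSeries.coeff_mul, completeSeries, PowerSeries.coeff_mk,
    mul_comm, succ_mul_complete]
  refine Finset.sum_congr rfl fun x _ => ?_
  rw [PowerSeries.coeff_derivative, symbolSeries, PowerSeries.coeff_succ_X_mul,
    PowerSeries.coeff_mk, PowerSeries.coeff_mk, mul_comm (u x.1)]

/-- The equation determines `n + 1` times each coefficient from the earlier ones, and `n + 1` is
invertible in a `ℚ`-algebra. This replaces explicit exponentials below. -/
theorem eq_of_derivative_eq_mul {E F G : PowerSeries A}
    (hF : PowerSeries.derivative A F = E * F) (hG : PowerSeries.derivative A G = E * G)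
    (h0 : PowerSeries.constantCoeff F = PowerSeries.constantCoeff G) : F = G := by
  ext n
  induction n using Nat.strong_induction_on with
  | _ n ih =>
    cases n with
    | zero => simpa using h0
    | succ n =>
      have h1 := congrArg (PowerSeries.coeff n) hF
      have h2 := congrArg (PowerSeries.coeff n) hG
      rw [PowerSeries.coeff_derivative, PowerSeries.coeff_mul] at h1 h2
      have h3 : PowerSeries.coeff (n + 1) F * ((n : A) + 1)
          = PowerSeries.coeff (n + 1) G * ((n : A) + 1) := by
        rw [h1, h2]
        refine Finset.sum_congr rfl fun x hx => ?_
        rw [ih x.2 (by have := Finset.HasAntidiagonal.mem_antidiagonal.1 hx; omega)]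
      have hu : IsUnit ((n : A) + 1) := by
        rw [show (n : A) + 1 = algebraMap ℚ A ((n : ℚ) + 1) by simp]
        exact (IsUnit.mk0 _ (by positivity)).map _
      exact hu.mul_right_cancel h3

theorem constantCoeff_completeSeries (u : ℕ → A) :
    PowerSeries.constantCoeff (completeSeries u) = 1 := by
  rw [completeSeries, ← PowerSeries.coeff_zero_eq_constantCoeff_apply, PowerSeries.coeff_mk,
    complete_zero]

/-- The exponential of a sum: by the Leibniz rule both sides solve the same linear differential
equation. -/
theorem completeSeries_add (u v : ℕ → A) :
    completeSeries (u + v) = completeSeries u * completeSeries v := by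
  refine eq_of_derivative_eq_mul (derivative_completeSeries _) ?_ (by
    simp [constantCoeff_completeSeries])
  have h : symbolSeries (u + v) = symbolSeries u + symbolSeries v := by
    rw [symbolSeries, symbolSeries, symbolSeries, ← mul_add]
    rfl
  rw [h, Derivation.leibniz, derivative_completeSeries, derivative_completeSeries, map_add]
  simp only [smul_eq_mul]
  ring

theorem complete_add (u v : ℕ → A) (n : ℕ) :
    complete (u + v) n = ∑ x ∈ Finset.HasAntidiagonal.antidiagonal n, complete u x.1 * complete v x.2 := by
  have := congrArg (PowerSeries.coeff n) (completeSeries_add u v)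
  simpa [completeSeries, PowerSeries.coeff_mul] using this

theorem completeSeries_unique {u : ℕ → A} {F : PowerSeries A}
    (h0 : PowerSeries.constantCoeff F = 1)
    (h : PowerSeries.derivative A F = PowerSeries.derivative A (symbolSeries u) * F) :
    F = completeSeries u :=
  eq_of_derivative_eq_mul h (derivative_completeSeries u)
    (h0.trans (constantCoeff_completeSeries u).symm)

theorem complete_pow_mul (t : A) (u : ℕ → A) (n : ℕ) :
    complete (fun k => t ^ (k + 1) * u k) n = t ^ n * complete u n := by
  rw [complete, complete, Finset.mul_sum]
  refine Finset.sum_congr rfl fun l _ => ?_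
  rw [multiset_prod_pow_mul _ (fun a ha => l.parts_pos ha), l.parts_sum, mul_smul_comm]

/-- By the chain rule, `H(y)` solves the equation that characterizes the exponential of `U(y)`. -/
theorem completeSeries_subst (u : ℕ → A) {y : PowerSeries A}
    (hy : PowerSeries.constantCoeff y = 0) {v : ℕ → A}
    (hv : symbolSeries v = (symbolSeries u).subst y) :
    completeSeries v = (completeSeries u).subst y := by
  have hs := PowerSeries.HasSubst.of_constantCoeff_zero' hy
  symm
  refine completeSeries_unique ?_ ?_
  · have := PowerSeries.constantCoeff_subst_eq_zero (a := y) hy (completeSeries u - 1) (by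
      simp [constantCoeff_completeSeries])
    rw [PowerSeries.subst_sub hs] at this
    rw [← PowerSeries.coe_substAlgHom hs] at this ⊢
    rw [map_one, map_sub] at this
    rw [← sub_eq_zero, ← this]
    simp [PowerSeries.constantCoeff]
  · rw [hv, PowerSeries.derivative_subst hs, PowerSeries.derivative_subst hs,
      derivative_completeSeries, PowerSeries.subst_mul hs]
    ring

/-- The transformed symbols have generating series `U(s X / (1 - X))`, so complete sums undergo the
same binomial transform as the symbols themselves. -/
theorem complete_binomial (s : A) (u : ℕ → A) (n : ℕ) :
    complete (fun k => ∑ m ∈ Finset.range (k + 1), ((k.choose m : A) * s ^ (m + 1)) * u m) (n + 1)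
      = ∑ m ∈ Finset.range (n + 1), ((n.choose m : A) * s ^ (m + 1)) * complete u (m + 1) := by
  have hy : PowerSeries.constantCoeff (mobius s) = 0 := by simp [mobius]
  have hv : symbolSeries
      (fun k => ∑ m ∈ Finset.range (k + 1), ((k.choose m : A) * s ^ (m + 1)) * u m)
        = (symbolSeries u).subst (mobius s) := by
    ext k
    cases k with
    | zero =>
      have := PowerSeries.constantCoeff_subst_eq_zero (a := mobius s) hy (symbolSeries u)
        (by simp [symbolSeries])
      rw [symbolSeries, PowerSeries.coeff_zero_X_mul]
      rw [PowerSeries.coeff_zero_eq_constantCoeff_apply]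
      exact this.symm
    | succ k =>
      rw [coeff_subst_mobius]
      simp [symbolSeries, PowerSeries.coeff_succ_X_mul]
  have := congrArg (PowerSeries.coeff (n + 1)) (completeSeries_subst u hy hv)
  rw [coeff_subst_mobius] at this
  simpa [completeSeries] using this

end Complete

/-! ### Squarefree polynomials -/

section Squarefree

set_option linter.unusedSectionVars false

variable {α : Type*} [Fintype α] [DecidableEq α]

open MvPolynomial

/-- The product of the variables in a finite set. -/
def varProd (S : Finset α) : MvPolynomial α ℚ := ∏ a ∈ S, X a

variable (α) in
/-- The space of squarefree homogeneous polynomials of degree `k`. -/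
def squarefreeSpace (k : ℕ) : Submodule ℚ (MvPolynomial α ℚ) :=
  Submodule.span ℚ (varProd '' {S : Finset α | S.card = k})

variable (α) in
/-- The derivation `∑ a, X a ^ 2 ∂/∂X a`. -/
def squareDer : Derivation ℚ (MvPolynomial α ℚ) (MvPolynomial α ℚ) :=
  mkDerivation ℚ fun a => X a ^ 2

variable (α) in
/-- The derivation `∑ a, ∂/∂X a`. -/
def lowering : Derivation ℚ (MvPolynomial α ℚ) (MvPolynomial α ℚ) :=
  mkDerivation ℚ fun _ => 1

variable (α) in
/-- The operator sending the product over `S` to the sum of the products over all sets obtained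
from `S` by adding one element. -/
def raising : MvPolynomial α ℚ →ₗ[ℚ] MvPolynomial α ℚ :=
  LinearMap.mulLeft ℚ (∑ a, X a) - (squareDer α).toLinearMap

theorem raising_apply (f : MvPolynomial α ℚ) :
    raising α f = (∑ a, X a) * f - squareDer α f := rfl

/-- The product of the differences `X a - X b` over a list of pairs. -/
def pairProd (l : List (α × α)) : MvPolynomial α ℚ := (l.map fun p => X p.1 - X p.2).prod

theorem derivation_sum_apply (s : Finset α)
    (d : α → Derivation ℚ (MvPolynomial α ℚ) (MvPolynomial α ℚ)) (f : MvPolynomial α ℚ) :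
    (∑ a ∈ s, d a) f = ∑ a ∈ s, d a f := by
  induction s using Finset.induction_on with
  | empty => simp
  | insert a s h ih => rw [Finset.sum_insert h, Finset.sum_insert h, Derivation.add_apply, ih]

theorem varProd_mem {S : Finset α} {k : ℕ} (h : S.card = k) :
    varProd S ∈ squarefreeSpace α k := Submodule.subset_span ⟨S, h, rfl⟩

theorem varProd_insert {a : α} {S : Finset α} (h : a ∉ S) :
    varProd (insert a S) = X a * varProd S := Finset.prod_insert h

theorem squareDer_varProd (S : Finset α) :
    squareDer α (varProd S) = varProd S * ∑ a ∈ S, X a := by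
  induction S using Finset.induction_on with
  | empty => simp [varProd]
  | insert a S h ih =>
    rw [varProd_insert h, Derivation.leibniz, ih, squareDer, mkDerivation_X, Finset.sum_insert h]
    simp only [smul_eq_mul]
    ring

/-- Each factor is an eigenvector up to a polynomial: `X a ^ 2 - X b ^ 2 = (X a - X b) (X a + X b)`.
So `raising` cancels the variables of the pairs just as it cancels those of a monomial. -/
theorem squareDer_pairProd (l : List (α × α)) :
    squareDer α (pairProd l) = pairProd l * (l.map fun p => X p.1 + X p.2).sum := by
  induction l with
  | nil => simp [pairProd]
  | cons p l ih =>
    have h : pairProd (p :: l) = (X p.1 - X p.2) * pairProd l := by simp [pairProd]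
    rw [h, Derivation.leibniz, ih, map_sub, squareDer, mkDerivation_X, mkDerivation_X,
      List.map_cons, List.sum_cons]
    simp only [smul_eq_mul]
    ring

theorem lowering_pairProd (l : List (α × α)) : lowering α (pairProd l) = 0 := by
  induction l with
  | nil => simp [pairProd]
  | cons p l ih =>
    have h : pairProd (p :: l) = (X p.1 - X p.2) * pairProd l := by simp [pairProd]
    rw [h, Derivation.leibniz, ih, map_sub, lowering, mkDerivation_X, mkDerivation_X]
    simp

theorem raising_varProd (S : Finset α) :
    raising α (varProd S) = ∑ a ∈ Sᶜ, varProd (insert a S) := by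
  rw [raising_apply, squareDer_varProd, ← Finset.sum_add_sum_compl S, add_mul, mul_comm (varProd S),
    add_sub_cancel_left, Finset.sum_mul]
  exact Finset.sum_congr rfl fun a ha => (varProd_insert (Finset.mem_compl.1 ha)).symm

theorem raising_mem {k : ℕ} {f : MvPolynomial α ℚ} (hf : f ∈ squarefreeSpace α k) :
    raising α f ∈ squarefreeSpace α (k + 1) := by
  refine (Submodule.span_le (p := (squarefreeSpace α (k + 1)).comap (raising α))).2 ?_ hf
  rintro _ ⟨S, hS, rfl⟩
  change raising α (varProd S) ∈ squarefreeSpace α (k + 1)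
  rw [raising_varProd]
  refine Submodule.sum_mem _ fun a ha => varProd_mem ?_
  rw [Finset.card_insert_of_notMem (Finset.mem_compl.1 ha)]
  exact congrArg (· + 1) hS

theorem squarefreeSpace_isHomogeneous {k : ℕ} {f : MvPolynomial α ℚ}
    (hf : f ∈ squarefreeSpace α k) : f.IsHomogeneous k := by
  rw [← mem_homogeneousSubmodule]
  refine (Submodule.span_le (p := homogeneousSubmodule α ℚ k)).2 ?_ hf
  rintro _ ⟨S, hS, rfl⟩
  have := IsHomogeneous.prod S (fun a => (X a : MvPolynomial α ℚ)) (fun _ => 1)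
    fun a _ => isHomogeneous_X ℚ a
  simp only [Finset.sum_const, smul_eq_mul, mul_one] at this
  rw [show S.card = k from hS] at this
  exact this

/-! ### The `sl₂` relation and injectivity of the raising operator -/

theorem lowering_apply (f : MvPolynomial α ℚ) : lowering α f = ∑ a, pderiv a f := by
  have h : lowering α = ∑ a, pderiv a := by
    refine derivation_ext fun b => ?_
    rw [lowering, mkDerivation_X, derivation_sum_apply]
    simp [pderiv_X, Pi.single_apply]
  rw [h, derivation_sum_apply]

theorem lowering_isHomogeneous {k : ℕ} {f : MvPolynomial α ℚ} (hf : f.IsHomogeneous (k + 1)) :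
    (lowering α f).IsHomogeneous k := by
  rw [lowering_apply]
  exact IsHomogeneous.sum _ _ _ fun a _ => hf.pderiv

/-- The commutator is a derivation sending `X b` to `2 X b`, hence twice the Euler operator. -/
theorem lowering_squareDer_commutator {k : ℕ} {f : MvPolynomial α ℚ} (hf : f.IsHomogeneous k) :
    lowering α (squareDer α f) - squareDer α (lowering α f) = (2 * k : ℚ) • f := by
  have h : ⁅lowering α, squareDer α⁆ = (2 : ℚ) • ∑ a, (X a : MvPolynomial α ℚ) • pderiv a := by
    refine derivation_ext fun b => ?_
    rw [Derivation.commutator_apply, lowering, squareDer, mkDerivation_X, mkDerivation_X,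
      Derivation.leibniz_pow, mkDerivation_X, Derivation.smul_apply, derivation_sum_apply]
    simp only [pderiv_X, Pi.single_apply, Derivation.smul_apply]
    simp [Algebra.smul_def]
    exact (map_ofNat C 2).symm
  rw [← Derivation.commutator_apply, h, Derivation.smul_apply, derivation_sum_apply]
  simp only [Derivation.smul_apply, smul_eq_mul]
  rw [hf.sum_X_mul_pderiv, mul_smul]
  congr 1

theorem lowering_raising {k : ℕ} {f : MvPolynomial α ℚ} (hf : f.IsHomogeneous k) :
    lowering α (raising α f)
      = raising α (lowering α f) + ((Fintype.card α : ℚ) - 2 * k) • f := by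
  have h := lowering_squareDer_commutator hf
  rw [raising_apply, raising_apply, map_sub, Derivation.leibniz, sub_smul, ← h]
  have h1 : lowering α (∑ a, X a) = algebraMap ℚ _ (Fintype.card α : ℚ) := by
    rw [map_sum]
    simp [lowering]
  rw [h1, Algebra.smul_def (Fintype.card α : ℚ) f]
  simp only [smul_eq_mul]
  ring

/-- Lowering the equation gives one of the same kind for `lowering α f`, one degree down and with
the larger constant `c + (|α| - 2k)`. Induction kills `lowering α f`, and then `c • f = 0` remains.
-/
theorem eq_zero_of_raising_lowering_add_smul {k : ℕ} : ∀ {f : MvPolynomial α ℚ} {c : ℚ},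
    f.IsHomogeneous k → 2 * k ≤ Fintype.card α → 0 < c →
      raising α (lowering α f) + c • f = 0 → f = 0 := by
  induction k with
  | zero =>
    intro f c hf _ hc h
    rw [← totalDegree_zero_iff_isHomogeneous, totalDegree_eq_zero_iff_eq_C] at hf
    have h0 : lowering α f = 0 := by
      rw [hf]
      exact (lowering α).map_algebraMap _
    rw [h0, map_zero, zero_add] at h
    exact (smul_eq_zero.1 h).resolve_left hc.ne'
  | succ k ih =>
    intro f c hf hk hc h
    have hk' : (2 * k + 2 : ℚ) ≤ Fintype.card α := by exact_mod_cast (by omega : 2 * k + 2 ≤ _)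
    have h1 := congrArg (lowering α) h
    rw [map_add, map_zero, lowering_raising (lowering_isHomogeneous hf), Derivation.map_smul,
      add_assoc, ← add_smul] at h1
    have h0 := ih (lowering_isHomogeneous hf) (by omega) (by linarith) h1
    rw [h0, map_zero, zero_add] at h
    exact (smul_eq_zero.1 h).resolve_left hc.ne'

theorem eq_zero_of_lowering_raising {k : ℕ} {f : MvPolynomial α ℚ} (hf : f.IsHomogeneous k)
    (hk : 2 * k < Fintype.card α) (h : lowering α (raising α f) = 0) : f = 0 := by
  rw [lowering_raising hf] at h
  refine eq_zero_of_raising_lowering_add_smul hf hk.le ?_ h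
  rw [sub_pos]
  exact_mod_cast hk

/-! ### Products of differences, and splitting the squarefree polynomials -/

variable (α) in
/-- The span of the products of `k` differences of variables in disjoint pairs. -/
def pairSpace (k : ℕ) : Submodule ℚ (MvPolynomial α ℚ) :=
  Submodule.span ℚ (pairProd '' {l | l.length = k ∧ (l.map Prod.fst ++ l.map Prod.snd).Nodup})

theorem lowering_eq_zero_of_mem_pairSpace {k : ℕ} {f : MvPolynomial α ℚ}
    (hf : f ∈ pairSpace α k) : lowering α f = 0 := by
  refine (Submodule.span_le (p := LinearMap.ker (lowering α).toLinearMap)).2 ?_ hf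
  rintro _ ⟨l, -, rfl⟩
  exact lowering_pairProd l

theorem pairProd_cons (p : α × α) (l : List (α × α)) :
    pairProd (p :: l) = (X p.1 - X p.2) * pairProd l := by simp [pairProd]

/-- Expanding one difference moves one of its two variables into `S`; disjointness keeps the product
squarefree. -/
theorem pairProd_mul_varProd_mem (l : List (α × α)) : ∀ (S : Finset α),
    (l.map Prod.fst ++ l.map Prod.snd).Nodup →
    (∀ p ∈ l, p.1 ∉ S ∧ p.2 ∉ S) →
      pairProd l * varProd S ∈ squarefreeSpace α (l.length + S.card) := by
  induction l with
  | nil =>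
    intro S _ _
    simpa [pairProd] using varProd_mem (S := S) rfl
  | cons p l ih =>
    intro S h hS
    have hp := hS p List.mem_cons_self
    simp only [List.map_cons, List.cons_append, List.nodup_cons, List.mem_append, List.mem_cons,
      List.mem_map, not_or, List.nodup_append] at h
    have hl : (l.map Prod.fst ++ l.map Prod.snd).Nodup := by
      rw [List.nodup_append]
      exact ⟨h.2.1, h.2.2.1.2, fun a ha b hb =>
        h.2.2.2 a (List.mem_map.1 ha) b (Or.inr (List.mem_map.1 hb))⟩
    have key : ∀ a, a ∉ S → (∀ q ∈ l, q.1 ≠ a ∧ q.2 ≠ a) →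
        pairProd l * varProd (insert a S) ∈ squarefreeSpace α ((p :: l).length + S.card) := by
      intro a ha hla
      have := ih (insert a S) hl fun q hq => by
        have h1 := hla q hq
        have h2 := hS q (List.mem_cons_of_mem _ hq)
        simp [Finset.mem_insert, h1.1, h1.2, h2.1, h2.2]
      rwa [Finset.card_insert_of_notMem ha, show l.length + (S.card + 1) =
        (p :: l).length + S.card by simp; omega] at this
    have h1 := key p.1 hp.1 fun q hq =>
      ⟨fun e => h.1.1 ⟨q, hq, e⟩, fun e => h.1.2.2 ⟨q, hq, e⟩⟩
    have h2 := key p.2 hp.2 fun q hq =>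
      ⟨fun e => h.2.2.2 q.1 ⟨q, hq, rfl⟩ p.2 (Or.inl rfl) e,
        fun e => h.2.2.1.1 ⟨q, hq, e⟩⟩
    have := Submodule.sub_mem _ h1 h2
    rw [varProd_insert hp.1, varProd_insert hp.2] at this
    rw [pairProd_cons]
    convert this using 1
    ring

theorem pairSpace_le (k : ℕ) : pairSpace α k ≤ squarefreeSpace α k := by
  refine Submodule.span_le.2 ?_
  rintro _ ⟨l, ⟨hl, hn⟩, rfl⟩
  have := pairProd_mul_varProd_mem l ∅ hn (by simp)
  simpa [varProd, hl] using this

/-- The labels occurring in a list of pairs. -/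
def pairSupport (l : List (α × α)) : Finset α := (l.map Prod.fst ++ l.map Prod.snd).toFinset

theorem sum_pairSupport {l : List (α × α)} (h : (l.map Prod.fst ++ l.map Prod.snd).Nodup) :
    ∑ a ∈ pairSupport l, (X a : MvPolynomial α ℚ) = (l.map fun p => X p.1 + X p.2).sum := by
  rw [pairSupport, List.sum_toFinset _ h, List.map_append, List.sum_append, List.sum_map_add]
  simp [Function.comp_def]

theorem raising_pairProd_mul_varProd {l : List (α × α)}
    (h : (l.map Prod.fst ++ l.map Prod.snd).Nodup) {S : Finset α}
    (hS : Disjoint (pairSupport l) S) :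
    raising α (pairProd l * varProd S)
      = ∑ a ∈ (pairSupport l ∪ S)ᶜ, X a * (pairProd l * varProd S) := by
  rw [raising_apply, Derivation.leibniz, squareDer_varProd, squareDer_pairProd,
    ← sum_pairSupport h, ← Finset.sum_add_sum_compl (pairSupport l ∪ S), Finset.sum_union hS,
    ← Finset.sum_mul]
  simp only [smul_eq_mul]
  ring

/-- Induction on the number of free variables: modulo the image of `raising`, a free variable can be
traded for differences with the unused variables, each of which forms a new disjoint pair. -/
theorem pairProd_mul_varProd_mem_sup {k : ℕ} (S : Finset α) : ∀ (l : List (α × α)),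
    (l.map Prod.fst ++ l.map Prod.snd).Nodup → Disjoint (pairSupport l) S →
    l.length + S.card = k + 1 →
      pairProd l * varProd S
        ∈ pairSpace α (k + 1) ⊔ (squarefreeSpace α k).map (raising α) := by
  induction S using Finset.induction_on with
  | empty =>
    intro l h _ hk
    refine Submodule.mem_sup_left (Submodule.subset_span ⟨l, ⟨by simpa using hk, h⟩, ?_⟩)
    simp [varProd]
  | insert s S hs ih =>
    intro l h hd hk
    rw [Finset.card_insert_of_notMem hs] at hk
    rw [Finset.disjoint_insert_right] at hd
    set g := pairProd l * varProd S with hg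
    have hgm : g ∈ squarefreeSpace α k := by
      have := pairProd_mul_varProd_mem l S h fun p hp => by
        constructor <;> refine Finset.disjoint_left.1 hd.2 ?_ <;>
          rw [pairSupport, List.mem_toFinset, List.mem_append]
        · exact Or.inl (List.mem_map_of_mem hp)
        · exact Or.inr (List.mem_map_of_mem hp)
      rwa [show l.length + S.card = k by omega] at this
    have hr : raising α g ∈ pairSpace α (k + 1) ⊔ (squarefreeSpace α k).map (raising α) :=
      Submodule.mem_sup_right (Submodule.mem_map_of_mem hgm)
    have hsmem : s ∈ (pairSupport l ∪ S)ᶜ := by simp [hd.1, hs]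
    have hdiff : ∀ b ∈ (pairSupport l ∪ S)ᶜ, (X s - X b) * g
        ∈ pairSpace α (k + 1) ⊔ (squarefreeSpace α k).map (raising α) := by
      intro b hb
      rcases eq_or_ne b s with rfl | hbs
      · simp
      rw [Finset.mem_compl, Finset.mem_union, not_or] at hb
      have hsl : s ∉ l.map Prod.fst ++ l.map Prod.snd := fun e => hd.1 (List.mem_toFinset.2 e)
      have hbl : b ∉ l.map Prod.fst ++ l.map Prod.snd := fun e => hb.1 (List.mem_toFinset.2 e)
      have hperm : (((s, b) :: l).map Prod.fst ++ ((s, b) :: l).map Prod.snd).Perm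
          (s :: b :: (l.map Prod.fst ++ l.map Prod.snd)) := by
        simp [List.perm_middle]
      have := ih ((s, b) :: l) (by
        rw [hperm.nodup_iff]
        simp only [List.nodup_cons, List.mem_cons, not_or]
        exact ⟨⟨hbs.symm, hsl⟩, hbl, h⟩) (by
        rw [pairSupport, List.toFinset_eq_of_perm _ _ hperm, List.toFinset_cons,
          List.toFinset_cons, Finset.disjoint_insert_left, Finset.disjoint_insert_left]
        exact ⟨hs, hb.2, hd.2⟩) (by simp; omega)
      rwa [pairProd_cons, mul_assoc] at this
    -- Averaging over the unused labels `b`: `raising α g` is the sum of the `X b * g`. The number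
    -- of labels is nonzero because `s` is one of them, so it can be divided out.
    have hsum : ((((pairSupport l ∪ S)ᶜ).card : ℕ) : ℚ) • (X s * g)
        = raising α g + ∑ b ∈ (pairSupport l ∪ S)ᶜ, (X s - X b) * g := by
      rw [hg, raising_pairProd_mul_varProd h hd.2, ← Finset.sum_add_distrib]
      simp_rw [← add_mul, add_sub_cancel]
      rw [Finset.sum_const, Nat.cast_smul_eq_nsmul]
    have hmem := Submodule.add_mem _ hr (Submodule.sum_mem _ hdiff)
    rw [← hsum] at hmem
    have hc : ((((pairSupport l ∪ S)ᶜ).card : ℕ) : ℚ) ≠ 0 :=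
      Nat.cast_ne_zero.2 (Finset.card_ne_zero_of_mem hsmem)
    rw [varProd_insert hs, mul_left_comm]
    exact (Submodule.smul_mem_iff _ hc).1 hmem

theorem squarefreeSpace_le_sup (k : ℕ) : squarefreeSpace α (k + 1)
    ≤ pairSpace α (k + 1) ⊔ (squarefreeSpace α k).map (raising α) := by
  refine Submodule.span_le.2 ?_
  rintro _ ⟨S, hS, rfl⟩
  have := pairProd_mul_varProd_mem_sup (k := k) S [] (by simp) (by simp [pairSupport])
    (by simpa using hS)
  simpa [pairProd] using this

end Squarefree

/-! ### Characters of squarefree polynomials -/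

section Trace

set_option linter.unusedSectionVars false

variable {α : Type*} [Fintype α] [DecidableEq α]

open MvPolynomial

theorem rename_varProd (σ : Equiv.Perm α) (S : Finset α) :
    rename σ (varProd S) = varProd (S.map σ.toEmbedding) := by
  simp [varProd, map_prod]

theorem rename_pairProd (σ : Equiv.Perm α) (l : List (α × α)) :
    rename σ (pairProd l) = pairProd (l.map (Prod.map σ σ)) := by
  simp [pairProd, map_list_prod, Function.comp_def]

theorem rename_squareDer (σ : Equiv.Perm α) (f : MvPolynomial α ℚ) :
    rename σ (squareDer α f) = squareDer α (rename σ f) := by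
  induction f using MvPolynomial.induction_on with
  | C a => simp [squareDer]
  | add p q hp hq => simp [hp, hq]
  | mul_X p a h =>
    rw [Derivation.leibniz, map_mul, Derivation.leibniz, map_add, rename_X, smul_eq_mul,
      smul_eq_mul, map_mul, map_mul, h, squareDer, mkDerivation_X, mkDerivation_X, map_pow,
      rename_X]
    rfl

theorem rename_raising (σ : Equiv.Perm α) (f : MvPolynomial α ℚ) :
    rename σ (raising α f) = raising α (rename σ f) := by
  rw [raising_apply, raising_apply, map_sub, map_mul, rename_squareDer, map_sum]
  simp only [rename_X]
  rw [Equiv.sum_comp σ fun a => (X a : MvPolynomial α ℚ)]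

theorem rename_mem_squarefreeSpace (σ : Equiv.Perm α) (k : ℕ) :
    ∀ f ∈ squarefreeSpace α k, (rename σ).toLinearMap f ∈ squarefreeSpace α k := by
  refine Submodule.span_le (p := (squarefreeSpace α k).comap (rename σ).toLinearMap).2 ?_
  rintro _ ⟨S, hS, rfl⟩
  change rename σ (varProd S) ∈ squarefreeSpace α k
  rw [rename_varProd]
  exact varProd_mem (by simpa using hS)

theorem rename_mem_pairSpace (σ : Equiv.Perm α) (k : ℕ) :
    ∀ f ∈ pairSpace α k, (rename σ).toLinearMap f ∈ pairSpace α k := by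
  refine Submodule.span_le (p := (pairSpace α k).comap (rename σ).toLinearMap).2 ?_
  rintro _ ⟨l, ⟨hl, hn⟩, rfl⟩
  change rename σ (pairProd l) ∈ pairSpace α k
  rw [rename_pairProd]
  refine Submodule.subset_span ⟨_, ⟨by simpa using hl, ?_⟩, rfl⟩
  have := hn.map σ.injective
  simpa [Function.comp_def] using this

theorem support_indicator_one (S : Finset α) :
    (Finsupp.indicator S fun _ _ => (1 : ℕ)).support = S := by
  ext a
  simp [Finsupp.indicator_apply]

theorem varProd_eq_monomial (S : Finset α) :
    varProd S = basisMonomials α ℚ (Finsupp.indicator S fun _ _ => 1) := by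
  rw [coe_basisMonomials]
  change _ = monomial _ 1
  rw [monomial_eq, varProd, Finsupp.prod, map_one, one_mul, support_indicator_one]
  refine Finset.prod_congr rfl fun a ha => ?_
  rw [Finsupp.indicator_of_mem ha, pow_one]

variable (α) in
/-- The basis of the squarefree polynomials given by the squarefree monomials. -/
def squarefreeBasis (k : ℕ) :
    Module.Basis {S : Finset α // S.card = k} ℚ (squarefreeSpace α k) :=
  Module.Basis.mk (v := fun S => ⟨varProd S.1, varProd_mem S.2⟩)
    (by
      refine LinearIndependent.of_comp (squarefreeSpace α k).subtype ?_
      have h := (basisMonomials α ℚ).linearIndependent.comp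
        (fun S : {S : Finset α // S.card = k} => Finsupp.indicator S.1 fun _ _ => 1) (by
          intro S T h
          have := congrArg Finsupp.support h
          rwa [support_indicator_one, support_indicator_one, ← Subtype.ext_iff] at this)
      have hv : (squarefreeSpace α k).subtype ∘ (fun S : {S : Finset α // S.card = k} =>
          (⟨varProd S.1, varProd_mem S.2⟩ : squarefreeSpace α k))
          = basisMonomials α ℚ ∘ fun S => Finsupp.indicator S.1 fun _ _ => 1 :=
        funext fun S => varProd_eq_monomial S.1
      rw [hv]
      exact h)
    (by
      rw [← Submodule.map_le_map_iff_of_injective (squarefreeSpace α k).injective_subtype,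
        Submodule.map_top, Submodule.range_subtype, Submodule.map_span]
      refine (Submodule.span_le.2 ?_ : squarefreeSpace α k ≤ _)
      rintro _ ⟨S, hS, rfl⟩
      exact Submodule.subset_span ⟨_, ⟨⟨S, hS⟩, rfl⟩, rfl⟩)

theorem coe_squarefreeBasis (k : ℕ) (S : {S : Finset α // S.card = k}) :
    (squarefreeBasis α k S : MvPolynomial α ℚ) = varProd S.1 := by
  simp [squarefreeBasis]

instance finite_squarefreeSpace (k : ℕ) : Module.Finite ℚ (squarefreeSpace α k) :=
  Module.Finite.of_basis (squarefreeBasis α k)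

instance finite_pairSpace (k : ℕ) : Module.Finite ℚ (pairSpace α k) :=
  Submodule.finiteDimensional_of_le (pairSpace_le k)

/-- The sets of `k` elements fixed by a permutation. -/
def fixedSets (σ : Equiv.Perm α) (k : ℕ) : Finset (Finset α) :=
  {S | S.card = k ∧ S.map σ.toEmbedding = S}

/-- On squarefree monomials the action is a permutation matrix, whose trace counts the fixed sets.
-/
theorem trace_squarefreeSpace (σ : Equiv.Perm α) (k : ℕ) :
    LinearMap.trace ℚ _ ((rename (R := ℚ) σ).toLinearMap.restrict (rename_mem_squarefreeSpace σ k))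
      = (fixedSets σ k).card := by
  rw [LinearMap.trace_eq_matrix_trace ℚ (squarefreeBasis α k), Matrix.trace]
  have h : ∀ S : {S : Finset α // S.card = k},
      (rename (R := ℚ) σ).toLinearMap.restrict (rename_mem_squarefreeSpace σ k)
        (squarefreeBasis α k S)
        = squarefreeBasis α k ⟨S.1.map σ.toEmbedding, by simpa using S.2⟩ := by
    intro S
    refine Subtype.ext ?_
    rw [LinearMap.coe_restrict_apply, coe_squarefreeBasis, coe_squarefreeBasis]
    exact rename_varProd σ S.1
  simp only [Matrix.diag_apply, LinearMap.toMatrix_apply, h, Module.Basis.repr_self,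
    Finsupp.single_apply, Subtype.ext_iff]
  rw [Finset.sum_boole, fixedSets]
  congr 1
  refine Finset.card_bij (fun S _ => S.1) ?_ ?_ ?_
  · intro S hS
    simp only [Finset.mem_filter, Finset.mem_univ, true_and] at hS ⊢
    exact ⟨S.2, hS⟩
  · intro S _ T _ h
    exact Subtype.ext h
  · intro S hS
    simp only [Finset.mem_filter, Finset.mem_univ, true_and] at hS
    exact ⟨⟨S, hS.1⟩, by simpa using hS.2, rfl⟩

/-- Here `M` is the direct sum of `P` and an isomorphic copy of `Q`, equivariantly for `f`. The
hypothesis `hinj` says at once that `r` is injective on `Q` and that its image meets `P` trivially.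
-/
theorem trace_restrict_eq_add {V : Type*} [AddCommGroup V] [Module ℚ V] {f r : V →ₗ[ℚ] V}
    {M P Q : Submodule ℚ V} [Module.Finite ℚ P] [Module.Finite ℚ Q]
    (hfr : ∀ x, f (r x) = r (f x)) (hM : ∀ x ∈ M, f x ∈ M) (hP : ∀ x ∈ P, f x ∈ P)
    (hQ : ∀ x ∈ Q, f x ∈ Q) (hPM : P ≤ M) (hr : ∀ x ∈ Q, r x ∈ M) (hsup : M ≤ P ⊔ Q.map r)
    (hinj : ∀ w ∈ P, ∀ q ∈ Q, w + r q = 0 → q = 0) :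
    LinearMap.trace ℚ _ (f.restrict hM)
      = LinearMap.trace ℚ _ (f.restrict hP) + LinearMap.trace ℚ _ (f.restrict hQ) := by
  rw [← LinearMap.trace_prodMap']
  let F : (P × Q) →ₗ[ℚ] M := LinearMap.coprod (Submodule.inclusion hPM) (r.restrict hr)
  have hF : ∀ x, (F x : V) = x.1 + r x.2 := fun x => rfl
  have hi : Function.Injective F := by
    rw [injective_iff_map_eq_zero]
    rintro ⟨⟨w, hw⟩, ⟨q, hq⟩⟩ h
    have h1 : w + r q = 0 := (hF _).symm.trans (congrArg Subtype.val h)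
    have h2 := hinj w hw q hq h1
    subst h2
    rw [map_zero, add_zero] at h1
    subst h1
    rfl
  have hs : Function.Surjective F := by
    rintro ⟨y, hy⟩
    obtain ⟨w, hw, _, ⟨q, hq, rfl⟩, rfl⟩ := Submodule.mem_sup.1 (hsup hy)
    exact ⟨(⟨w, hw⟩, ⟨q, hq⟩), rfl⟩
  let e := LinearEquiv.ofBijective F ⟨hi, hs⟩
  rw [← LinearMap.trace_conj' _ e]
  congr 1
  refine LinearMap.ext fun y => ?_
  obtain ⟨x, rfl⟩ := e.surjective y
  rw [LinearEquiv.conj_apply_apply, e.symm_apply_apply]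
  refine Subtype.ext ?_
  change f ((x.1 : V) + r x.2) = f x.1 + r (f x.2)
  rw [map_add, hfr]

theorem trace_pairSpace_succ (σ : Equiv.Perm α) {k : ℕ} (hk : 2 * k < Fintype.card α) :
    LinearMap.trace ℚ _
        ((rename (R := ℚ) σ).toLinearMap.restrict (rename_mem_pairSpace σ (k + 1)))
      = (fixedSets σ (k + 1)).card - (fixedSets σ k).card := by
  rw [eq_sub_iff_add_eq, ← trace_squarefreeSpace σ k, ← trace_squarefreeSpace σ (k + 1)]
  refine (trace_restrict_eq_add (r := raising α) (rename_raising σ) _ _ _ (pairSpace_le (k + 1))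
    (fun _ => raising_mem) (squarefreeSpace_le_sup k) fun w hw q hq h => ?_).symm
  -- Products of differences are killed by `lowering`, so applying it to the relation leaves only
  -- the raised term.
  refine eq_zero_of_lowering_raising (squarefreeSpace_isHomogeneous hq) hk ?_
  have := congrArg (lowering α) h
  rwa [map_add, lowering_eq_zero_of_mem_pairSpace hw, zero_add, map_zero] at this

theorem pairSpace_zero : pairSpace α 0 = squarefreeSpace α 0 := by
  refine le_antisymm (pairSpace_le 0) (Submodule.span_le.2 ?_)
  rintro _ ⟨S, hS, rfl⟩
  refine Submodule.subset_span ⟨[], ⟨rfl, by simp⟩, ?_⟩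
  rw [Finset.card_eq_zero.1 (show S.card = 0 from hS)]
  simp [pairProd, varProd]

theorem trace_restrict_congr {V : Type*} [AddCommGroup V] [Module ℚ V] (f : V →ₗ[ℚ] V)
    {p q : Submodule ℚ V} (h : p = q) (hp : ∀ x ∈ p, f x ∈ p) (hq : ∀ x ∈ q, f x ∈ q) :
    LinearMap.trace ℚ _ (f.restrict hp) = LinearMap.trace ℚ _ (f.restrict hq) := by
  subst h
  rfl

/-- The number of fixed sets of cardinality `k`, minus that of cardinality `k - 1`. -/
theorem trace_pairSpace (σ : Equiv.Perm α) {k : ℕ} (hk : 2 * k ≤ Fintype.card α) :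
    LinearMap.trace ℚ _ ((rename (R := ℚ) σ).toLinearMap.restrict (rename_mem_pairSpace σ k))
      = (fixedSets σ k).card - (if k = 0 then 0 else ((fixedSets σ (k - 1)).card : ℚ)) := by
  cases k with
  | zero =>
    rw [trace_restrict_congr _ pairSpace_zero _ (rename_mem_squarefreeSpace σ 0),
      trace_squarefreeSpace]
    simp
  | succ k =>
    rw [trace_pairSpace_succ σ (by omega)]
    simp

end Trace

/-! ### Diagrams with at most two rows -/

section TwoRows

/-- The diagram has a first row of length `j`, a second row of length `i` and no other rows. -/
def HasTwoRows (μ : YoungDiagram) (j i : ℕ) : Prop :=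
  ∀ x : ℕ × ℕ, x ∈ μ.cells ↔ (x.1 = 0 ∧ x.2 < j) ∨ (x.1 = 1 ∧ x.2 < i)

variable {μ : YoungDiagram} {i j : ℕ}

theorem HasTwoRows.card_eq (h : HasTwoRows μ j i) : μ.card = j + i := by
  have hc : μ.cells = ({0} ×ˢ Finset.range j) ∪ ({1} ×ˢ Finset.range i) := by
    ext ⟨r, c⟩
    rw [h]
    simp
    omega
  rw [YoungDiagram.card, hc, Finset.card_union_of_disjoint]
  · simp
  · rw [Finset.disjoint_left]
    rintro ⟨r, c⟩ h1 h2
    simp only [Finset.mem_product, Finset.mem_singleton] at h1 h2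
    omega

/-- The cells of the first `i` columns: those in the first row, then those in the second row. -/
def HasTwoRows.cell (h : HasTwoRows μ j i) (hij : i ≤ j) :
    Fin i ⊕ Fin i → {x : ℕ × ℕ // x ∈ μ.cells}
  | .inl c => ⟨(0, c), (h _).2 (Or.inl ⟨rfl, c.2.trans_le hij⟩)⟩
  | .inr c => ⟨(1, c), (h _).2 (Or.inr ⟨rfl, c.2⟩)⟩

theorem HasTwoRows.cell_injective (h : HasTwoRows μ j i) (hij : i ≤ j) :
    Function.Injective (h.cell hij) := by
  rintro (a | a) (b | b) hab <;>
    simp only [HasTwoRows.cell, Subtype.mk.injEq, Prod.mk.injEq] at hab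
  · exact congrArg _ (Fin.ext hab.2)
  · omega
  · omega
  · exact congrArg _ (Fin.ext hab.2)

theorem HasTwoRows.spechtPoly_eq (h : HasTwoRows μ j i) (hij : i ≤ j) (t : Tableau μ) :
    spechtPoly t = ∏ c : Fin i, (MvPolynomial.X (t.symm (h.cell hij (.inl c)))
      - MvPolynomial.X (t.symm (h.cell hij (.inr c)))) := by
  rw [spechtPoly, ← Finset.prod_product', Finset.univ_product_univ, ← Finset.prod_filter]
  symm
  refine Finset.prod_bij
    (fun c _ => (t.symm (h.cell hij (.inl c)), t.symm (h.cell hij (.inr c)))) ?_ ?_ ?_ ?_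
  · intro c _
    simp [HasTwoRows.cell]
  · intro c _ d _ hcd
    have := h.cell_injective hij (t.symm.injective (Prod.mk.inj hcd).1)
    simpa using this
  · rintro ⟨a, b⟩ hab
    simp only [Finset.mem_filter, Finset.mem_univ, true_and] at hab
    have ha := (h _).1 (t a).2
    have hb := (h _).1 (t b).2
    refine ⟨⟨(t b).1.2, by omega⟩, Finset.mem_univ _, ?_⟩
    rw [Prod.mk.injEq, Equiv.symm_apply_eq, Equiv.symm_apply_eq]
    refine ⟨Subtype.ext (Prod.ext ?_ ?_), Subtype.ext (Prod.ext ?_ ?_)⟩ <;>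
      simp only [HasTwoRows.cell] <;> omega
  · intro c _
    rfl

theorem pairProd_ofFn {n i : ℕ} (a b : Fin i → Fin n) :
    pairProd (List.ofFn fun c => (a c, b c))
      = ∏ c, (MvPolynomial.X (a c) - MvPolynomial.X (b c)) := by
  rw [pairProd, List.map_ofFn, List.prod_ofFn]
  rfl

theorem nodup_ofFn_append {β : Type*} {i : ℕ} (a b : Fin i → β) :
    (List.ofFn a ++ List.ofFn b).Nodup ↔ Function.Injective (Sum.elim a b) := by
  rw [List.nodup_append, List.nodup_ofFn, List.nodup_ofFn]
  simp only [List.mem_ofFn', Set.mem_range, forall_exists_index, forall_apply_eq_imp_iff]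
  exact ⟨fun h => h.1.sumElim h.2.1 h.2.2, fun h => ⟨h.comp Sum.inl_injective,
    h.comp Sum.inr_injective, fun x y e => by simpa using @h (.inl x) (.inr y) e⟩⟩

/-- The columns of height two give disjoint pairs of labels. Conversely, any `i` disjoint ordered
pairs can be placed in the first `i` columns and completed to a tableau. -/
theorem HasTwoRows.spechtModule_eq (h : HasTwoRows μ j i) (hij : i ≤ j) :
    spechtModule μ = pairSpace (Fin μ.card) i := by
  refine le_antisymm (Submodule.span_le.2 ?_) (Submodule.span_le.2 ?_)
  · rintro _ ⟨t, rfl⟩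
    refine Submodule.subset_span ⟨List.ofFn fun c => (t.symm (h.cell hij (.inl c)),
      t.symm (h.cell hij (.inr c))), ⟨List.length_ofFn, ?_⟩, ?_⟩
    · rw [List.map_ofFn, List.map_ofFn, nodup_ofFn_append]
      have := t.symm.injective.comp (h.cell_injective hij)
      convert this using 1
      funext x
      cases x <;> rfl
    · rw [pairProd_ofFn, h.spechtPoly_eq hij]
  · rintro _ ⟨l, ⟨hl, hn⟩, rfl⟩
    subst hl
    have hof : l = List.ofFn fun c => ((l.get c).1, (l.get c).2) := (List.ofFn_get l).symm
    rw [hof, List.map_ofFn, List.map_ofFn, nodup_ofFn_append] at hn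
    have t₀ : Tableau μ := Fintype.equivOfCardEq (by simp [YoungDiagram.card])
    set x : Fin l.length ⊕ Fin l.length → Fin μ.card := Sum.elim
      (fun c => (l.get c).1) (fun c => (l.get c).2) with hx
    have hxi : Function.Injective x := hn
    have hyi := t₀.symm.injective.comp (h.cell_injective hij)
    set y := t₀.symm ∘ h.cell hij with hy
    -- The labels of the given pairs are matched with those that `t₀` puts in the corresponding
    -- cells; extending this matching to a permutation corrects `t₀` to the required tableau.
    let e : {a // a ∈ Set.range x} ≃ {a // a ∈ Set.range y} :=
      (Equiv.ofInjective x hxi).symm.trans (Equiv.ofInjective y hyi)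
    have he : ∀ c, t₀ (e.extendSubtype (x c)) = h.cell hij c := by
      intro c
      rw [Equiv.extendSubtype_apply_of_mem e _ ⟨c, rfl⟩]
      have : (Equiv.ofInjective x hxi).symm ⟨x c, ⟨c, rfl⟩⟩ = c :=
        (Equiv.symm_apply_eq _).2 rfl
      change t₀ (Equiv.ofInjective y hyi ((Equiv.ofInjective x hxi).symm ⟨x c, ⟨c, rfl⟩⟩)).1 = _
      rw [this, Equiv.ofInjective_apply, hy]
      simp
    refine Submodule.subset_span ⟨e.extendSubtype.trans t₀, ?_⟩
    rw [h.spechtPoly_eq hij]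
    conv_rhs => rw [hof, pairProd_ofFn]
    have he' : ∀ c, (e.extendSubtype.trans t₀).symm (h.cell hij c) = x c := fun c => by
      rw [Equiv.symm_apply_eq, Equiv.trans_apply, he]
    simp only [he']
    rfl

theorem HasTwoRows.character_eq (h : HasTwoRows μ j i) (hij : i ≤ j)
    (σ : Equiv.Perm (Fin μ.card)) : (spechtRep μ).character σ
      = (fixedSets σ i).card - (if i = 0 then 0 else ((fixedSets σ (i - 1)).card : ℚ)) := by
  rw [← trace_pairSpace σ (by rw [Fintype.card_fin, h.card_eq]; omega)]
  exact trace_restrict_congr _ (h.spechtModule_eq hij) (spechtModule_le_comap μ σ) _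

theorem hasTwoRows_diagram_pair {i j : ℕ} (hij : i ≤ j) : HasTwoRows (diagram [j, i]) j i := by
  rintro ⟨r, c⟩
  have hs : [j, i].insertionSort (· ≥ ·) = [j, i] := by
    simp [hij]
  rw [YoungDiagram.mem_cells, diagram, YoungDiagram.mem_ofRowLens]
  simp only [hs]
  rcases r with _ | _ | r <;> simp

theorem hasTwoRows_diagram_singleton (j : ℕ) : HasTwoRows (diagram [j]) j 0 := by
  rintro ⟨r, c⟩
  rw [YoungDiagram.mem_cells, diagram, YoungDiagram.mem_ofRowLens]
  rcases r with _ | r <;> simp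

theorem hasTwoRows_diagram_nil : HasTwoRows (diagram []) 0 0 := by
  rintro ⟨r, c⟩
  rw [YoungDiagram.mem_cells, diagram, YoungDiagram.mem_ofRowLens]
  simp

end TwoRows

/-! ### Sets fixed by a permutation -/

section FixedSets

set_option linter.unusedSectionVars false

variable {α : Type*} [Fintype α] [DecidableEq α] {σ : Equiv.Perm α}

theorem map_perm_eq_self {S : Finset α} (h : ∀ x ∈ S, σ x ∈ S) : S.map σ.toEmbedding = S := by
  refine Finset.eq_of_subset_of_card_le (fun y hy => ?_) (Finset.card_map _).ge
  obtain ⟨x, hx, rfl⟩ := Finset.mem_map.1 hy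
  exact h x hx

theorem perm_apply_mem {S : Finset α} (h : S.map σ.toEmbedding = S) {x : α} (hx : x ∈ S) :
    σ x ∈ S := by
  rw [← h]
  exact Finset.mem_map_of_mem σ.toEmbedding hx

theorem mem_of_sameCycle {S : Finset α} (h : S.map σ.toEmbedding = S) {x y : α} (hx : x ∈ S)
    (hxy : σ.SameCycle x y) : y ∈ S := by
  obtain ⟨n, rfl⟩ := hxy.exists_nat_pow_eq
  induction n with
  | zero => simpa
  | succ n ih =>
    rw [pow_succ', Equiv.Perm.mul_apply]
    exact perm_apply_mem h (ih ⟨n, by simp⟩)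

variable (σ) in
/-- The generating polynomial of the fixed sets of a permutation is the product over its cycles,
fixed points included. -/
theorem prod_partition_eq_sum {A : Type*} [CommRing A] (t : A) :
    (σ.partition.parts.map fun a => 1 + t ^ a).prod
      = ∑ S : Finset α with S.map σ.toEmbedding = S, t ^ S.card := by
  have h1 : (σ.partition.parts.map fun a => 1 + t ^ a).prod
      = (∏ c ∈ σ.cycleFactorsFinset, (1 + t ^ c.support.card)) * ∏ x ∈ σ.supportᶜ, (1 + t) := by
    rw [Equiv.Perm.parts_partition, Multiset.map_add, Multiset.prod_add, Multiset.map_replicate,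
      Multiset.prod_replicate, Equiv.Perm.cycleType_def, Multiset.map_map, Finset.prod_const,
      Finset.card_compl, pow_one]
    rfl
  rw [h1, Finset.prod_one_add, Finset.prod_one_add, Finset.sum_mul_sum, ← Finset.sum_product']
  -- An invariant set is uniquely a union of supports of nontrivial cycles and a set of fixed
  -- points, which are the choices made in expanding the two products.
  refine Finset.sum_nbij' (fun x => x.1.biUnion Equiv.Perm.support ∪ x.2)
    (fun S => (σ.cycleFactorsFinset.filter fun c => c.support ⊆ S, S \ σ.support)) ?_ ?_ ?_ ?_ ?_
  · rintro ⟨C, F⟩ h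
    simp only [Finset.mem_product, Finset.mem_powerset] at h
    simp only [Finset.mem_filter, Finset.mem_univ, true_and]
    refine map_perm_eq_self fun x hx => ?_
    rcases Finset.mem_union.1 hx with hx | hx
    · obtain ⟨c, hc, hxc⟩ := Finset.mem_biUnion.1 hx
      refine Finset.mem_union_left _ (Finset.mem_biUnion.2 ⟨c, hc, ?_⟩)
      rw [← (Equiv.Perm.mem_cycleFactorsFinset_iff.1 (h.1 hc)).2 x hxc]
      exact Equiv.Perm.apply_mem_support.2 hxc
    · have := h.2 hx
      rw [Finset.mem_compl, Equiv.Perm.notMem_support] at this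
      rw [this]
      exact Finset.mem_union_right _ hx
  · intro S _
    simp only [Finset.mem_product, Finset.mem_powerset]
    refine ⟨Finset.filter_subset _ _, fun x hx => ?_⟩
    exact Finset.mem_compl.2 (Finset.mem_sdiff.1 hx).2
  · rintro ⟨C, F⟩ h
    simp only [Finset.mem_product, Finset.mem_powerset] at h
    refine Prod.ext (Finset.ext fun c => ?_) (Finset.ext fun x => ?_)
    · simp only [Finset.mem_filter]
      constructor
      · rintro ⟨hc, hs⟩
        obtain ⟨x, hx⟩ := (Equiv.Perm.mem_cycleFactorsFinset_iff.1 hc).1.nonempty_support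
        rcases Finset.mem_union.1 (hs hx) with hx' | hx'
        · obtain ⟨d, hd, hxd⟩ := Finset.mem_biUnion.1 hx'
          rw [Equiv.Perm.cycle_is_cycleOf hx hc,
            ← Equiv.Perm.cycle_is_cycleOf hxd (h.1 hd)]
          exact hd
        · exact absurd (Equiv.Perm.mem_cycleFactorsFinset_support_le hc hx)
            (Finset.mem_compl.1 (h.2 hx'))
      · intro hc
        exact ⟨h.1 hc, fun x hx => Finset.mem_union_left _ (Finset.mem_biUnion.2 ⟨c, hc, hx⟩)⟩
    · simp only [Finset.mem_sdiff, Finset.mem_union, Finset.mem_biUnion]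
      constructor
      · rintro ⟨⟨c, hc, hx⟩ | hx, hn⟩
        · exact absurd (Equiv.Perm.mem_cycleFactorsFinset_support_le (h.1 hc) hx) hn
        · exact hx
      · exact fun hx => ⟨Or.inr hx, Finset.mem_compl.1 (h.2 hx)⟩
  · intro S hS
    simp only [Finset.mem_filter, Finset.mem_univ, true_and] at hS
    ext x
    simp only [Finset.mem_union, Finset.mem_biUnion, Finset.mem_filter, Finset.mem_sdiff]
    constructor
    · rintro (⟨c, ⟨_, hc⟩, hx⟩ | hx)
      · exact hc hx
      · exact hx.1
    · intro hx
      by_cases hs : x ∈ σ.support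
      · refine Or.inl ⟨σ.cycleOf x, ⟨Equiv.Perm.cycleOf_mem_cycleFactorsFinset_iff.2 hs,
          fun y hy => ?_⟩, Equiv.Perm.mem_support_cycleOf_iff.2 ⟨Equiv.Perm.SameCycle.refl _ _, hs⟩⟩
        exact mem_of_sameCycle hS hx (Equiv.Perm.mem_support_cycleOf_iff.1 hy).1
      · exact Or.inr ⟨hx, hs⟩
  · rintro ⟨C, F⟩ h
    simp only [Finset.mem_product, Finset.mem_powerset] at h
    rw [Finset.card_union_of_disjoint, Finset.card_biUnion, pow_add, Finset.prod_pow_eq_pow_sum,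
      Finset.prod_const]
    · intro c hc d hd hcd
      exact (Equiv.Perm.cycleFactorsFinset_pairwise_disjoint σ (h.1 hc) (h.1 hd)
        hcd).disjoint_support
    · rw [Finset.disjoint_left]
      intro x hx hx'
      obtain ⟨c, hc, hxc⟩ := Finset.mem_biUnion.1 hx
      exact Finset.mem_compl.1 (h.2 hx')
        (Equiv.Perm.mem_cycleFactorsFinset_support_le (h.1 hc) hxc)

theorem coeff_prod_partition {A : Type*} [CommRing A] (k : ℕ) :
    (σ.partition.parts.map fun a => 1 + (Polynomial.X : Polynomial A) ^ a).prod.coeff k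
      = ((fixedSets σ k).card : A) := by
  rw [prod_partition_eq_sum, Polynomial.finsetSum_coeff]
  simp only [Polynomial.coeff_X_pow]
  rw [Finset.sum_boole, Finset.filter_filter, fixedSets]
  congr 2
  ext S
  simp only [Finset.mem_filter, Finset.mem_univ, true_and]
  constructor
  · exact fun h => ⟨h.2.symm, h.1⟩
  · exact fun h => ⟨h.2, h.1.symm⟩

end FixedSets

/-! ### Jacobi–Trudi formula for at most two rows -/

/-- The operator `D_(n)`, as a polynomial in the symbols. -/
def rowPoly (A : Type*) [CommRing A] [Algebra ℚ A] (n : ℕ) : MvPolynomial ℕ A :=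
  complete MvPolynomial.X n

/-- Compare the coefficients of `t^k` in the complete sum of the symbols `(1 + t^a) d_a`. Additivity
turns it into products of complete sums, while each partition contributes the product of the `1 +
t^a`, which counts fixed sets. -/
theorem complete_mul_complete {A : Type*} [CommRing A] [Algebra ℚ A] (u : ℕ → A) {n k : ℕ}
    (hk : k ≤ n) :
    complete u (n - k) * complete u k = ∑ l : Nat.Partition n,
      (((fixedSets (permOfPartition l) k).card : ℚ) / multisetAut l.parts) •
        (l.parts.map fun a => u (a - 1)).prod := by
  have h1 : ∀ x : ℕ × ℕ, complete (fun m => Polynomial.C (u m)) x.1 *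
      complete (fun m => (Polynomial.X : Polynomial A) ^ (m + 1) * Polynomial.C (u m)) x.2
      = Polynomial.C (complete u x.1 * complete u x.2) * Polynomial.X ^ x.2 := by
    intro x
    rw [complete_pow_mul, ← map_complete Polynomial.C, ← map_complete Polynomial.C, map_mul]
    ring
  have h2 := congrArg (Polynomial.coeff · k) (complete_add (fun m => Polynomial.C (u m))
    (fun m => (Polynomial.X : Polynomial A) ^ (m + 1) * Polynomial.C (u m)) n)
  simp only [h1, Polynomial.finsetSum_coeff, Polynomial.coeff_C_mul, Polynomial.coeff_X_pow] at h2
  rw [Finset.sum_eq_single (n - k, k) ?_ ?_] at h2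
  · rw [if_pos rfl, mul_one] at h2
    rw [← h2, complete, Polynomial.finsetSum_coeff]
    refine Finset.sum_congr rfl fun l _ => ?_
    have h3 : (l.parts.map fun a => ((fun m => Polynomial.C (u m)) + fun m =>
        (Polynomial.X : Polynomial A) ^ (m + 1) * Polynomial.C (u m)) (a - 1)).prod
        = (l.parts.map fun a => 1 + (Polynomial.X : Polynomial A) ^ a).prod *
          Polynomial.C (l.parts.map fun a => u (a - 1)).prod := by
      rw [map_multiset_prod, Multiset.map_map, ← Multiset.prod_map_mul]
      refine congrArg _ (Multiset.map_congr rfl fun a ha => ?_)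
      have := l.parts_pos ha
      simp only [Pi.add_apply, Function.comp_apply, Nat.sub_add_cancel this]
      ring
    have h4 : (l.parts.map fun a => 1 + (Polynomial.X : Polynomial A) ^ a).prod.coeff k
        = ((fixedSets (permOfPartition l) k).card : A) := by
      rw [← (exists_perm_parts l).choose_spec]
      exact coeff_prod_partition k
    rw [h3, Polynomial.coeff_smul, Polynomial.coeff_mul_C, h4,
      div_eq_mul_one_div ((fixedSets (permOfPartition l) k).card : ℚ),
      mul_comm ((fixedSets (permOfPartition l) k).card : ℚ), mul_smul, Nat.cast_smul_eq_nsmul,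
      nsmul_eq_mul]
  · rintro ⟨p, q⟩ hx hne
    rw [Finset.HasAntidiagonal.mem_antidiagonal] at hx
    rw [if_neg, mul_zero]
    rintro rfl
    refine hne (Prod.ext ?_ rfl)
    simp only at hx ⊢
    omega
  · intro h
    exact absurd (Finset.HasAntidiagonal.mem_antidiagonal.2 (Nat.sub_add_cancel hk)) h

/-- The difference of fixed-set counts in the character becomes the difference of two products of
complete sums. -/
theorem HasTwoRows.D_eq {μ : YoungDiagram} {j i : ℕ} (h : HasTwoRows μ j i) (hij : i ≤ j) :
    D μ = rowPoly ℚ j * rowPoly ℚ i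
      - (if i = 0 then 0 else rowPoly ℚ (j + 1) * rowPoly ℚ (i - 1)) := by
  have hD : D μ = ∑ l : Nat.Partition μ.card,
      (((fixedSets (permOfPartition l) i).card
        - (if i = 0 then 0 else ((fixedSets (permOfPartition l) (i - 1)).card : ℚ)))
          / multisetAut l.parts) •
        (l.parts.map fun a => (MvPolynomial.X (a - 1) : MvPolynomial ℕ ℚ)).prod := by
    refine Finset.sum_congr rfl fun l _ => ?_
    rw [chi, h.character_eq hij, MvPolynomial.smul_eq_C_mul]
    rfl
  rw [hD]
  simp only [sub_div, sub_smul, Finset.sum_sub_distrib]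
  have hc := h.card_eq
  rw [← complete_mul_complete MvPolynomial.X (by omega), rowPoly, rowPoly,
    show μ.card - i = j by omega]
  congr 1
  split_ifs with hi
  · simp
  · rw [← complete_mul_complete MvPolynomial.X (by omega), rowPoly, rowPoly,
      show μ.card - (i - 1) = j + 1 by omega]

theorem rowPoly_zero (A : Type*) [CommRing A] [Algebra ℚ A] : rowPoly A 0 = 1 := complete_zero _

theorem D_nil : D (diagram []) = 1 := by
  rw [hasTwoRows_diagram_nil.D_eq le_rfl, rowPoly_zero]
  simp

theorem D_singleton (n : ℕ) : D (diagram [n]) = rowPoly ℚ n := by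
  rw [(hasTwoRows_diagram_singleton n).D_eq (Nat.zero_le _), rowPoly_zero]
  simp

theorem D_pair {i j : ℕ} (hij : i + 1 ≤ j) : D (diagram [j, i + 1])
    = rowPoly ℚ j * rowPoly ℚ (i + 1) - rowPoly ℚ (j + 1) * rowPoly ℚ i := by
  rw [(hasTwoRows_diagram_pair hij).D_eq hij]
  simp

/-! ### The chain rule for the change of variables -/

section ChainRule

variable {R : Type*} [CommRing R]

theorem coeff_linearForm (a : ℕ → R) (e : ℕ →₀ ℕ) : MvPowerSeries.coeff e (linearForm a)
    = ∑ m ∈ e.support, if e = Finsupp.single m 1 then a m else 0 := rfl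

theorem pderiv_linearForm (a : ℕ → R) (k : ℕ) :
    MvPowerSeries.pderiv R k (linearForm a) = MvPowerSeries.C (a k) := by
  ext e
  rw [MvPowerSeries.coeff_pderiv, coeff_linearForm, MvPowerSeries.coeff_C]
  by_cases he : e = 0
  · subst he
    simp
  · rw [if_neg he, Finset.sum_eq_zero, zero_mul]
    intro m _
    rw [if_neg]
    intro h
    refine he (Finsupp.ext fun x => ?_)
    have h1 := DFunLike.congr_fun h x
    have h2 := DFunLike.congr_fun h k
    simp only [Finsupp.add_apply, Finsupp.single_apply, Finsupp.zero_apply] at h1 h2 ⊢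
    grind

/-- Binomial inversion: it makes the transformed derivatives dual to the series `pOfT s b`.
Factoring out `binom(k, b)` leaves an alternating row sum of Pascal's triangle. -/
theorem sum_choose_inversion (k b : ℕ) :
    ∑ m ∈ Finset.range (k + 1), ((k.choose m : ℤ) * if b ≤ m then (-1) ^ (m - b) * (m.choose b : ℤ)
      else 0) = if k = b then 1 else 0 := by
  rcases lt_or_ge k b with h | h
  · rw [if_neg h.ne]
    refine Finset.sum_eq_zero fun m hm => ?_
    rw [Finset.mem_range] at hm
    rw [if_neg (by omega), mul_zero]
  · obtain ⟨d, rfl⟩ := Nat.exists_eq_add_of_le h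
    rw [add_assoc, Finset.sum_range_add, Finset.sum_eq_zero, zero_add]
    · have h1 : ∀ x ∈ Finset.range (d + 1), (((b + d).choose (b + x) : ℤ) *
          if b ≤ b + x then (-1) ^ (b + x - b) * ((b + x).choose b : ℤ) else 0)
          = ((b + d).choose b : ℤ) * ((-1) ^ x * (d.choose x : ℤ)) := by
        intro x hx
        rw [if_pos (Nat.le_add_right _ _), Nat.add_sub_cancel_left]
        have := Nat.choose_mul (n := b + d) (k := b + x) (s := b)
          (Nat.le_add_right _ _)
        rw [Nat.add_sub_cancel_left, Nat.add_sub_cancel_left] at this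
        have h2 : ((b + d).choose (b + x) : ℤ) * ((b + x).choose b : ℤ)
            = ((b + d).choose b : ℤ) * (d.choose x : ℤ) := by exact_mod_cast this
        linear_combination (-1) ^ x * h2
      rw [Finset.sum_congr rfl h1, ← Finset.mul_sum, Int.alternating_sum_range_choose]
      rcases d with _ | d <;> simp
    · intro m hm
      rw [Finset.mem_range] at hm
      rw [if_neg (by omega), mul_zero]

/-- The operator `∑_{m ≤ k} binom(k, m) s ^ (m + 1) ∂/∂T_{m+1}`. -/
def transformedPderiv (s : Rˣ) (k : ℕ) : MvPowerSeries ℕ R →ₗ[R] MvPowerSeries ℕ R :=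
  ∑ m ∈ Finset.range (k + 1),
    ((k.choose m : R) * (s : R) ^ (m + 1)) • (MvPowerSeries.pderiv R m).toLinearMap

theorem transformedPderiv_apply (s : Rˣ) (k : ℕ) (f : MvPowerSeries ℕ R) :
    transformedPderiv s k f = ∑ m ∈ Finset.range (k + 1),
      ((k.choose m : R) * (s : R) ^ (m + 1)) • MvPowerSeries.pderiv R m f := by
  simp [transformedPderiv, LinearMap.sum_apply]

theorem transformedPderiv_mul (s : Rˣ) (k : ℕ) (f g : MvPowerSeries ℕ R) :
    transformedPderiv s k (f * g)
      = f * transformedPderiv s k g + g * transformedPderiv s k f := by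
  simp only [transformedPderiv_apply, Derivation.leibniz, smul_add, Finset.sum_add_distrib,
    Finset.mul_sum, smul_eq_mul, mul_smul_comm]

theorem transformedPderiv_pOfT (s : Rˣ) (k b : ℕ) :
    transformedPderiv s k (pOfT s b) = if k = b then 1 else 0 := by
  have h : ∀ m ∈ Finset.range (k + 1),
      ((k.choose m : R) * (s : R) ^ (m + 1)) • MvPowerSeries.pderiv R m (pOfT s b)
        = MvPowerSeries.C (Int.cast ((k.choose m : ℤ) *
          if b ≤ m then (-1) ^ (m - b) * (m.choose b : ℤ) else 0) : R) := by
    intro m _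
    rw [pOfT, pderiv_linearForm, MvPowerSeries.smul_eq_C_mul, ← map_mul]
    congr 1
    split_ifs with hb
    · push_cast
      have hs : (s : R) ^ (m + 1) * ((s⁻¹ : Rˣ) : R) ^ (m + 1) = 1 := by
        rw [← mul_pow, Units.mul_inv, one_pow]
      linear_combination (k.choose m : R) * (-1) ^ (m - b) * (m.choose b : R) * hs
    · simp
  rw [transformedPderiv_apply, Finset.sum_congr rfl h, ← map_sum, ← Int.cast_sum,
    sum_choose_inversion]
  split_ifs <;> simp

theorem continuous_pderiv [TopologicalSpace R] [IsTopologicalRing R] (k : ℕ) :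
    @Continuous _ _ (MvPowerSeries.WithPiTopology.instTopologicalSpace R)
      (MvPowerSeries.WithPiTopology.instTopologicalSpace R) (MvPowerSeries.pderiv (σ := ℕ) R k) := by
  let := MvPowerSeries.WithPiTopology.instTopologicalSpace (σ := ℕ) R
  refine continuous_pi fun e => ?_
  have : (fun f : MvPowerSeries ℕ R => MvPowerSeries.pderiv R k f e)
      = fun f => MvPowerSeries.coeff (e + Finsupp.single k 1) f * ((e k : R) + 1) :=
    funext fun f => MvPowerSeries.coeff_pderiv f e
  rw [this]
  exact (MvPowerSeries.WithPiTopology.continuous_coeff R _).mul continuous_const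

theorem subst_pderiv_coe (s : Rˣ) (k : ℕ) (p : MvPolynomial ℕ R) :
    MvPowerSeries.subst (pOfT s) (MvPowerSeries.pderiv R k (p : MvPowerSeries ℕ R))
      = transformedPderiv s k (MvPowerSeries.subst (pOfT s) (p : MvPowerSeries ℕ R)) := by
  have ha := hasSubst_pOfT s
  rw [← MvPowerSeries.coe_substAlgHom ha]
  induction p using MvPolynomial.induction_on with
  | C r =>
    rw [MvPolynomial.coe_C, MvPowerSeries.pderiv_C, map_zero]
    have : MvPowerSeries.substAlgHom ha (MvPowerSeries.C r) = MvPowerSeries.C r := by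
      rw [MvPowerSeries.coe_substAlgHom, MvPowerSeries.subst_C]
    rw [this, transformedPderiv_apply]
    simp
  | add p q hp hq => rw [MvPolynomial.coe_add, map_add, map_add, hp, hq, map_add, map_add]
  | mul_X p b hp =>
    rw [MvPolynomial.coe_mul, MvPolynomial.coe_X, Derivation.leibniz, map_add, smul_eq_mul,
      smul_eq_mul, map_mul, map_mul, map_mul, transformedPderiv_mul, hp,
      MvPowerSeries.substAlgHom_X, transformedPderiv_pOfT, MvPowerSeries.pderiv_X]
    congr 2
    rw [Pi.single_apply]
    rcases eq_or_ne k b with h | h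
    · rw [if_pos h, if_pos h.symm, map_one]
    · rw [if_neg h, if_neg h.symm, map_zero]

/-- For polynomials this follows from the Leibniz rule and the values on the variables. Both sides
are continuous for the coefficientwise topology over discrete `R`, in which polynomials are dense.
-/
theorem subst_pderiv (s : Rˣ) (k : ℕ) (f : MvPowerSeries ℕ R) :
    MvPowerSeries.subst (pOfT s) (MvPowerSeries.pderiv R k f)
      = transformedPderiv s k (MvPowerSeries.subst (pOfT s) f) := by
  let : UniformSpace R := ⊥
  have : DiscreteUniformity R := ⟨rfl⟩
  let := MvPowerSeries.WithPiTopology.instTopologicalSpace (σ := ℕ) R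
  have := MvPowerSeries.WithPiTopology.instT2Space (σ := ℕ) (R := R)
  have := MvPowerSeries.WithPiTopology.instIsTopologicalRing (σ := ℕ) R
  have hs : Continuous (MvPowerSeries.subst (pOfT s) : MvPowerSeries ℕ R → MvPowerSeries ℕ R) :=
    MvPowerSeries.continuous_subst (hasSubst_pOfT s)
  have ht : Continuous (transformedPderiv s k) := by
    have : ⇑(transformedPderiv s k) = fun f => ∑ m ∈ Finset.range (k + 1),
        MvPowerSeries.C ((k.choose m : R) * (s : R) ^ (m + 1)) * MvPowerSeries.pderiv R m f :=
      funext fun f => by simp only [transformedPderiv_apply, MvPowerSeries.smul_eq_C_mul]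
    rw [this]
    exact continuous_finsetSum _ fun m _ => continuous_const.mul (continuous_pderiv m)
  have := MvPowerSeries.WithPiTopology.denseRange_toMvPowerSeries (σ := ℕ) (R := R)
  exact congrFun (this.equalizer (hs.comp (continuous_pderiv k)) (ht.comp hs)
    (funext fun p => subst_pderiv_coe s k p)) f

theorem diffOp_C (r : R) (f : MvPowerSeries ℕ R) : diffOp R (MvPolynomial.C r) f = r • f := by
  rw [← MvPolynomial.algebraMap_eq, AlgHom.commutes]
  rfl

variable [Algebra ℚ R]

theorem subst_diffOp (s : Rˣ) (P : MvPolynomial ℕ ℚ) : ∀ f : MvPowerSeries ℕ R,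
    MvPowerSeries.subst (pOfT s) (diffOp R (MvPolynomial.map (algebraMap ℚ R) P) f)
      = diffOp R (changeOp s P) (MvPowerSeries.subst (pOfT s) f) := by
  have ha := hasSubst_pOfT s
  induction P using MvPolynomial.induction_on with
  | C r =>
    intro f
    have : changeOp s (MvPolynomial.C r) = MvPolynomial.C (algebraMap ℚ R r) :=
      MvPolynomial.aeval_C _ r
    rw [MvPolynomial.map_C, this, diffOp_C, diffOp_C, MvPowerSeries.subst_smul ha]
  | add P Q hP hQ =>
    intro f
    simp only [map_add, LinearMap.add_apply, MvPowerSeries.subst_add ha, hP, hQ]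
  | mul_X P k hP =>
    intro f
    rw [map_mul, map_mul, MvPolynomial.map_X, Module.End.mul_apply, hP, map_mul, map_mul,
      Module.End.mul_apply, diffOp_X, subst_pderiv, transformedPderiv_apply]
    congr 1
    rw [changeOp, MvPolynomial.aeval_X, map_sum, LinearMap.sum_apply]
    refine Finset.sum_congr rfl fun m _ => ?_
    rw [map_mul, Module.End.mul_apply, diffOp_X, diffOp_C]

theorem subst_Hir (s : Rˣ) (i j : ℕ) (τ : MvPowerSeries ℕ R) :
    MvPowerSeries.subst (pOfT s) (Hir i j τ)
      = transformedHir s i j (MvPowerSeries.subst (pOfT s) τ) := by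
  have ha := hasSubst_pOfT s
  simp only [Hir, transformedHir, hirotaForm, MvPowerSeries.subst_add ha,
    MvPowerSeries.subst_sub ha, MvPowerSeries.subst_mul ha, subst_diffOp]

end ChainRule

/-! ### The bilinear form of the Hirota equations -/

section Bilinear

variable {R B K : Type*} [CommRing R] [CommRing B] [Algebra R B] [CommRing K] [Algebra R K]

/-- The Plücker-type expression underlying the Hirota equations. The pairs `(v, v')` and `(w, w')`
stand for consecutive terms of the sequence of operators, and `e` for its term number `1`. -/
def plucker (φ : B →ₗ[R] K) (e v v' w w' : B) : K :=
  φ 1 * φ (w * v' - w' * v) - φ v * φ (w * e - w') + φ w * φ (v * e - v')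

variable (φ : B →ₗ[R] K) (e v v' w w' : B)

theorem plucker_swap : plucker φ e w w' v v' = -plucker φ e v v' w w' := by
  simp only [plucker, map_sub, mul_comm v, mul_comm v' w]
  ring_nf

theorem plucker_self : plucker φ e v v' v v' = 0 := by
  simp only [plucker, mul_comm v' v, sub_self, map_zero]
  ring

theorem plucker_sum_left {ι : Type*} (t : Finset ι) (c : ι → R) (x x' : ι → B) :
    plucker φ e (∑ m ∈ t, c m • x m) (∑ m ∈ t, c m • x' m) w w'
      = ∑ m ∈ t, c m • plucker φ e (x m) (x' m) w w' := by
  simp only [plucker, Finset.mul_sum, Finset.sum_mul, map_sub, map_sum, mul_smul_comm,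
    smul_mul_assoc, map_smul, smul_add, smul_sub, Finset.sum_add_distrib, Finset.sum_sub_distrib,
    mul_sub]

theorem plucker_sum_right {ι : Type*} (t : Finset ι) (c : ι → R) (x x' : ι → B) :
    plucker φ e v v' (∑ m ∈ t, c m • x m) (∑ m ∈ t, c m • x' m)
      = ∑ m ∈ t, c m • plucker φ e v v' (x m) (x' m) := by
  rw [← neg_inj, ← plucker_swap, plucker_sum_left, ← Finset.sum_neg_distrib]
  refine Finset.sum_congr rfl fun m _ => ?_
  rw [plucker_swap, smul_neg]

/-- The summands `v` and `w` added to the second entries cancel in the first product, and in the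
other two they leave `φ v * φ w - φ w * φ v = 0`. -/
theorem plucker_shift (s : R) :
    plucker φ (s • e) v (v + s • v') w (w + s • w') = s • plucker φ e v v' w w' := by
  simp only [plucker, mul_add, add_mul, mul_smul_comm, smul_mul_assoc, map_sub, map_add, map_smul,
    smul_add, smul_sub, mul_sub, mul_comm w v]
  ring

/-- The expression `plucker` for the terms number `a` and `b` of a sequence of operators. -/
def pluckerSeq (g : ℕ → B) (a b : ℕ) : K := plucker φ (g 1) (g a) (g (a + 1)) (g b) (g (b + 1))

/-- The binomial transform of a sequence of operators, in degree `n + 1`. -/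
def binomialTransform (s : R) (g : ℕ → B) (n : ℕ) : B :=
  ∑ m ∈ Finset.range (n + 1), ((n.choose m : R) * s ^ (m + 1)) • g (m + 1)

theorem binomialTransform_zero (s : R) (g : ℕ → B) : binomialTransform s g 0 = s • g 1 := by
  simp [binomialTransform]

theorem binomialTransform_eq_sum (s : R) (g : ℕ → B) {n N : ℕ} (h : n < N) :
    binomialTransform s g n = ∑ m ∈ Finset.range N,
      ((n.choose m : R) * s ^ (m + 1)) • g (m + 1) := by
  refine Finset.sum_subset (Finset.range_subset_range.2 h) fun m _ hm => ?_
  rw [Nat.choose_eq_zero_of_lt (by simpa using hm)]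
  simp

/-- Pascal's rule. It presents two consecutive transformed terms in the shape `v`, `v + s • v'`
required by `plucker_shift`. -/
theorem binomialTransform_succ (s : R) (g : ℕ → B) (n : ℕ) :
    binomialTransform s g (n + 1)
      = binomialTransform s g n + s • binomialTransform s (fun m => g (m + 1)) n := by
  rw [binomialTransform_eq_sum s g (Nat.lt_add_one _),
    Finset.sum_range_succ' _ (n + 1), binomialTransform_eq_sum s g (show n < n + 1 + 1 by omega),
    Finset.sum_range_succ' _ (n + 1),
    binomialTransform, Finset.smul_sum, add_right_comm, ← Finset.sum_add_distrib]
  congr 1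
  · refine Finset.sum_congr rfl fun m _ => ?_
    rw [Nat.choose_succ_succ, smul_smul, ← add_smul]
    congr 1
    push_cast
    ring
  · simp

theorem pluckerSeq_transform (s : R) (g G : ℕ → B)
    (hG : ∀ n, G (n + 1) = binomialTransform s g n) {a b N : ℕ} (ha : a < N) (hb : b < N) :
    pluckerSeq φ G (a + 1) (b + 1) = ∑ m ∈ Finset.range N, ∑ n ∈ Finset.range N,
      ((a.choose m : R) * (b.choose n : R)) •
        (s ^ (m + n + 3) • pluckerSeq φ g (m + 1) (n + 1)) := by
  -- The exponent `m + n + 3` collects `s ^ (m + 1)` and `s ^ (n + 1)` from the two transforms and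
  -- one `s` from `plucker_shift`.
  rw [pluckerSeq, show G 1 = s • g 1 from (hG 0).trans (binomialTransform_zero s g), hG, hG, hG, hG,
    binomialTransform_succ,
    binomialTransform_succ, plucker_shift, binomialTransform_eq_sum s g ha,
    binomialTransform_eq_sum s _ ha, binomialTransform_eq_sum s g hb,
    binomialTransform_eq_sum s _ hb, plucker_sum_left, Finset.smul_sum]
  refine Finset.sum_congr rfl fun m _ => ?_
  rw [plucker_sum_right, Finset.smul_sum, Finset.smul_sum]
  refine Finset.sum_congr rfl fun n _ => ?_
  rw [smul_smul, smul_smul, smul_smul, pluckerSeq]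
  congr 1
  ring

theorem sum_antisymmetric (N : ℕ) (q : ℕ → ℕ → R) (f : ℕ → ℕ → K) (h0 : ∀ m, f m m = 0)
    (h : ∀ m n, f n m = -f m n) :
    ∑ m ∈ Finset.range N, ∑ n ∈ Finset.range N, q m n • f m n
      = ∑ x ∈ (Finset.range N ×ˢ Finset.range N).filter (fun x => x.1 < x.2),
          (q x.1 x.2 - q x.2 x.1) • f x.1 x.2 := by
  have hneg : ∑ x ∈ (Finset.range N ×ˢ Finset.range N).filter (fun x => ¬ x.1 < x.2),
      q x.1 x.2 • f x.1 x.2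
      = ∑ x ∈ (Finset.range N ×ˢ Finset.range N).filter (fun x => x.1 < x.2),
          q x.2 x.1 • f x.2 x.1 := by
    symm
    -- The diagonal terms vanish, so comparing nonzero terms only lets the swap match the remaining
    -- half with `x.1 < x.2`.
    refine Finset.sum_bij_ne_zero (fun x _ _ => x.swap) ?_ ?_ ?_ ?_
    · rintro ⟨m, n⟩ hx _
      simp only [Finset.mem_filter, Finset.mem_product, Prod.swap_prod_mk] at hx ⊢
      exact ⟨hx.1.symm, by omega⟩
    · intro x _ _ y _ _ hxy
      exact Prod.swap_injective hxy
    · rintro ⟨m, n⟩ hx hne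
      simp only [Finset.mem_filter, Finset.mem_product] at hx
      have hmn : m ≠ n := by
        rintro rfl
        exact hne (by rw [h0, smul_zero])
      refine ⟨(n, m), ?_, hne, rfl⟩
      simp only [Finset.mem_filter, Finset.mem_product]
      exact ⟨hx.1.symm, by omega⟩
    · rintro ⟨m, n⟩ _ _
      rfl
  rw [← Finset.sum_product', ← Finset.sum_filter_add_sum_filter_not _ (fun x => x.1 < x.2), hneg,
    ← Finset.sum_add_distrib]
  refine Finset.sum_congr rfl fun x _ => ?_
  rw [h x.1 x.2, sub_smul, smul_neg, sub_eq_add_neg]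

end Bilinear

/-! ### Transformation of the Hirota equations -/

section Transformation

set_option linter.unusedSectionVars false

variable {R : Type*} [CommRing R] [Algebra ℚ R]

theorem hirotaForm_eq_pluckerSeq (T : MvPolynomial ℕ ℚ →+* MvPolynomial ℕ R)
    (τ : MvPowerSeries ℕ R) {i j : ℕ} (hij : i + 2 ≤ j) :
    hirotaForm (fun P => diffOp R (T P) τ) (i + 2) j
      = pluckerSeq ((diffOp R).toLinearMap.flip τ) (fun n => T (rowPoly ℚ n)) (i + 1) j := by
  rw [hirotaForm, D_nil, D_singleton, D_singleton, D_pair hij, pluckerSeq, plucker,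
    show i + 2 - 1 = i + 1 by omega, D_pair (i := 0) (by omega), D_pair (i := 0) (by omega),
    rowPoly_zero, mul_one, mul_one]
  have h : ∀ P, diffOp R P τ = (diffOp R).toLinearMap.flip τ P := fun _ => rfl
  simp only [h]
  simp only [map_sub, map_mul T, map_one T, Nat.zero_add]

theorem map_rowPoly (n : ℕ) :
    MvPolynomial.map (algebraMap ℚ R) (rowPoly ℚ n) = rowPoly R n := by
  rw [rowPoly, map_complete]
  simp only [MvPolynomial.map_X]
  rfl

theorem changeOp_rowPoly (s : Rˣ) (n : ℕ) :
    changeOp s (rowPoly ℚ (n + 1)) = binomialTransform (s : R) (rowPoly R) n := by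
  have h : (fun k => changeOp s (MvPolynomial.X k)) = fun k => ∑ m ∈ Finset.range (k + 1),
      ((k.choose m : MvPolynomial ℕ R) * MvPolynomial.C (s : R) ^ (m + 1)) * MvPolynomial.X m := by
    funext k
    rw [changeOp, MvPolynomial.aeval_X]
    simp
  have h2 : changeOp s (rowPoly ℚ (n + 1))
      = complete (fun k => changeOp s (MvPolynomial.X k)) (n + 1) :=
    map_complete (changeOp s : MvPolynomial ℕ ℚ →+* MvPolynomial ℕ R) _ _
  rw [h2, h, complete_binomial, binomialTransform]
  refine Finset.sum_congr rfl fun m _ => ?_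
  rw [MvPolynomial.smul_eq_C_mul, rowPoly]
  simp

theorem Hir_eq_pluckerSeq (τ : MvPowerSeries ℕ R) {i j : ℕ} (hij : i + 2 ≤ j) :
    Hir (i + 2) j τ = pluckerSeq ((diffOp R).toLinearMap.flip τ) (rowPoly R) (i + 1) j := by
  rw [Hir, hirotaForm_eq_pluckerSeq (MvPolynomial.map (algebraMap ℚ R)) τ hij]
  congr 1
  exact funext map_rowPoly

/-- The coefficient of `Hir_{x,y}` in the transformed equation `Hir_{i,j}`. -/
def hirotaCoeff (i j x y : ℕ) : ℚ :=
  ((i - 2).choose (x - 2) : ℚ) * ((j - 1).choose (y - 1) : ℚ)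
    - ((i - 2).choose (y - 1) : ℚ) * ((j - 1).choose (x - 2) : ℚ)

/-- The subtracted product vanishes because `i - 2 < j - 1`. -/
theorem hirotaCoeff_self {i j : ℕ} (hi : 2 ≤ i) (hij : i ≤ j) : hirotaCoeff i j i j = 1 := by
  rw [hirotaCoeff, Nat.choose_self, Nat.choose_self, Nat.choose_eq_zero_of_lt (by omega)]
  simp

theorem transformedHir_eq {i j : ℕ} (hi : 2 ≤ i) (hij : i ≤ j) (s : Rˣ) (τ : MvPowerSeries ℕ R) :
    transformedHir s i j τ
      = ∑ x ∈ (Finset.Icc 2 i ×ˢ Finset.Icc 2 j).filter (fun x => x.1 ≤ x.2),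
          (algebraMap ℚ R (hirotaCoeff i j x.1 x.2) * (s : R) ^ (x.1 + x.2)) • Hir x.1 x.2 τ := by
  obtain ⟨a, rfl⟩ := Nat.exists_eq_add_of_le' hi
  obtain ⟨b, rfl⟩ : ∃ b, j = b + 1 := ⟨j - 1, by omega⟩
  set φ := (diffOp R).toLinearMap.flip τ with hφ
  have h1 : transformedHir s (a + 2) (b + 1) τ
      = pluckerSeq φ (fun n => changeOp s (rowPoly ℚ n)) (a + 1) (b + 1) :=
    hirotaForm_eq_pluckerSeq (changeOp s : MvPolynomial ℕ ℚ →+* MvPolynomial ℕ R) τ hij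
  rw [h1, pluckerSeq_transform φ (s : R) (rowPoly R) _ (changeOp_rowPoly s)
    (show a < b + 1 by omega) (Nat.lt_add_one b),
    sum_antisymmetric (b + 1) (fun m n => (a.choose m : R) * (b.choose n : R))
      (fun m n => (s : R) ^ (m + n + 3) • pluckerSeq φ (rowPoly R) (m + 1) (n + 1))
      (fun m => by rw [pluckerSeq, plucker_self, smul_zero])
      (fun m n => by rw [pluckerSeq, plucker_swap, smul_neg, add_comm n m]; rfl)]
  symm
  -- `Hir x y` involves the terms number `x - 1` and `y`, while the transform counts from `m + 1`
  -- and `n + 1`. Hence `m = x - 2` and `n = y - 1`, so that `x ≤ y` is `m < n` and `m + n + 3 = x +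
  -- y`.
  refine Finset.sum_bij_ne_zero (fun x _ _ => (x.1 - 2, x.2 - 1)) ?_ ?_ ?_ ?_
  · rintro ⟨x, y⟩ hx _
    simp only [Finset.mem_filter, Finset.mem_product, Finset.mem_Icc, Finset.mem_range] at hx ⊢
    omega
  · rintro ⟨x, y⟩ hx _ ⟨x', y'⟩ hx' _ h
    simp only [Finset.mem_filter, Finset.mem_product, Finset.mem_Icc, Prod.mk.injEq] at hx hx' h ⊢
    omega
  · rintro ⟨m, n⟩ hx hne
    simp only [Finset.mem_filter, Finset.mem_product, Finset.mem_range] at hx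
    -- If `m > a` then also `n > a`, so both products in the antisymmetrized coefficient vanish.
    -- This yields the bound `x ≤ i`.
    have hma : m ≤ a := by
      by_contra hma
      refine hne ?_
      rw [Nat.choose_eq_zero_of_lt (show a < m by omega),
        Nat.choose_eq_zero_of_lt (show a < n by omega)]
      simp
    refine ⟨(m + 2, n + 1), ?_, ?_, rfl⟩
    · simp only [Finset.mem_filter, Finset.mem_product, Finset.mem_Icc]
      omega
    · convert hne using 1
      rw [Hir_eq_pluckerSeq τ (show m + 2 ≤ n + 1 by omega), smul_smul, hirotaCoeff]
      congr 1
      simp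
      ring
  · rintro ⟨x, y⟩ hx _
    simp only [Finset.mem_filter, Finset.mem_product, Finset.mem_Icc] at hx
    obtain ⟨m, rfl⟩ := Nat.exists_eq_add_of_le' hx.1.1.1
    obtain ⟨n, rfl⟩ : ∃ n, y = n + 1 := ⟨y - 1, by omega⟩
    rw [Hir_eq_pluckerSeq τ hx.2, smul_smul, hirotaCoeff]
    congr 1
    simp
    ring

end Transformation

end HirotaKP

end

theorem proposition4p3 (i j : ℕ) (hi : 2 ≤ i) (hij : i ≤ j) :
    ∃ c : ℕ → ℕ → ℚ, c i j = 1 ∧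
      ∀ (R : Type*) [CommRing R] [Algebra ℚ R] (s : Rˣ) (τ : MvPowerSeries ℕ R),
        HirotaKP.transformedHir s i j τ
            = ∑ x ∈ (Finset.Icc 2 i ×ˢ Finset.Icc 2 j).filter (fun x => x.1 ≤ x.2),
                (algebraMap ℚ R (c x.1 x.2) * (s : R) ^ (x.1 + x.2)) • HirotaKP.Hir x.1 x.2 τ
        ∧ MvPowerSeries.subst (HirotaKP.pOfT s) (HirotaKP.Hir i j τ)
            = ∑ x ∈ (Finset.Icc 2 i ×ˢ Finset.Icc 2 j).filter (fun x => x.1 ≤ x.2),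
                (algebraMap ℚ R (c x.1 x.2) * (s : R) ^ (x.1 + x.2)) •
                  HirotaKP.Hir x.1 x.2 (MvPowerSeries.subst (HirotaKP.pOfT s) τ) := by
  -- The same constants serve both claims, since substitution turns the second into the first for
  -- the substituted series.
  refine ⟨HirotaKP.hirotaCoeff i j, HirotaKP.hirotaCoeff_self hi hij, fun R _ _ s τ => ⟨?_, ?_⟩⟩
  · exact HirotaKP.transformedHir_eq hi hij s τ
  · rw [HirotaKP.subst_Hir, HirotaKP.transformedHir_eq hi hij]
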